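/- Let $\Omega\subset\mathbb{R}^3$ be open, with coordinates $x=(x_1,x_2,z)$; let $L$ be the part of the $z$-axis in $\Omega$, $\Omega_L=\Omega\setminus L$, and $r=(x_1^2+x_2^2)^{1/2}$. For $z\in\mathbb{R}$ let $\Omega_z=\{(x_1,x_2)\in\mathbb{R}^2 : (x_1,x_2,z)\in\Omega\}$. Latin indices run over $1,2,3$ (the value $3$ is also written $z$), Greek indices over $1,2$, repeated indices are summed, and $\epsilon_{\alpha\beta}$ is the planar permutation symbol ($\epsilon_{12}=-\epsilon_{21}=1$, $\epsilon_{11}=\epsilon_{22}=0$). Let $\mathcal{E}^\star_{ij}$ be a symmetric tensor field on $\Omega$ that is smooth on $\Omega_L$, integrable on $\Omega$, independent of $z$ on $\Omega_L$, and compatible on $\Omega_L$ in the sense that there are real constants $K,a_1,a_2,b$ with $$\epsilon_{\alpha\gamma}\epsilon_{\beta\delta}\partial_\alpha\partial_\beta\mathcal{E}^\star_{\gamma\delta}=0,\qquad \epsilon_{\alpha\beta}\partial_\alpha\mathcal{E}^\star_{\beta z}=K,\qquad \mathcal{E}^\star_{zz}=a_\alpha x_\alpha+b\qquad\text{on }\Omega_L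 .$$ Assume moreover that the distributional derivatives $\partial_\alpha\mathcal{E}^\star_{\alpha i}$ $(i=1,2,3)$ and $\partial_\gamma\mathcal{E}^\star_{\kappa\kappa}$ $(\gamma=1,2)$ are signed Radon measures on $\Omega$, i.e. differences of two positive measures that are finite on compact subsets of $\Omega$. Then there are functions $E_\kappa,e_\kappa$ and symmetric tensor fields $E_{\alpha\beta},e_{\alpha\beta}$ of the planar coordinates $(x_1,x_2)$, locally integrable on $\Omega_z$ for every $z$, such that on $\Omega_L$ $$\mathcal{E}^\star_{\kappa z}=E_\kappa+e_\kappa,\qquad \mathcal{E}^\star_{\alpha\beta}=E_{\alpha\beta}+e_{\alpha\beta},$$ and, for every $z$, in the sense of distributions on the whole of $\Omega_z$ (including the point of $L$, if any), $$\epsilon_{\alpha\beta}\partial_\alpha E_\beta=0,\qquad \epsilon_{\alpha\gamma}\epsilon_{\beta\delta}\partial_\alpha\partial_\beta E_{\gamma\delta}=0,$$ while $e_\kappa=o(r^{-2})$ and $e_{\alpha\beta}=o(r^{-2})$ as $r\to0^+$. -/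

import Mathlib

open MeasureTheory Topology Filter Asymptotics TopologicalSpace
open scoped ContDiff Distributions LineDeriv

namespace StrainDecomp

/-- Three-dimensional Euclidean space; coordinates `0`, `1`, `2` are `x`, `y`, `z`. -/
abbrev Space := EuclideanSpace ℝ (Fin 3)

/-- The plane of the coordinates `x`, `y`. -/
abbrev Plane := EuclideanSpace ℝ (Fin 2)

/-- A planar (Greek) index, seen as a spatial (Latin) index. -/
abbrev sp (α : Fin 2) : Fin 3 := α.castSucc

/-- The vertical index `z`. -/
abbrev zi : Fin 3 := 2

/-- The `i`-th Cartesian base vector. -/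
noncomputable abbrev base {n : ℕ} (i : Fin n) : EuclideanSpace ℝ (Fin n) :=
  EuclideanSpace.single i 1

/-- The planar permutation symbol `ε_{αβ}`. -/
def eps : Matrix (Fin 2) (Fin 2) ℝ := !![0, 1; -1, 0]

/-- The planar coordinates `(x, y)` of a point of space. -/
noncomputable def planar (x : Space) : Plane := !₂[x 0, x 1]

/-- The point of the horizontal plane at height `z` with given planar coordinates. -/
noncomputable def lift (z : ℝ) (y : Plane) : Space := !₂[y 0, y 1, z]

theorem continuous_lift (z : ℝ) : Continuous (lift z) := by
  unfold lift
  refine (PiLp.continuous_toLp 2 _).comp (continuous_pi fun i => ?_)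
  fin_cases i
  · exact (EuclideanSpace.proj (0 : Fin 2) : Plane →L[ℝ] ℝ).continuous
  · exact (EuclideanSpace.proj (1 : Fin 2) : Plane →L[ℝ] ℝ).continuous
  · exact continuous_const

/-- The slice `Ω_z` of `Ω` at height `z`, as an open subset of the plane. -/
noncomputable def slice (Ω : Opens Space) (z : ℝ) : Opens Plane :=
  ⟨lift z ⁻¹' (Ω : Set Space), Ω.isOpen.preimage (continuous_lift z)⟩

/-- `Ω_L`: the domain `Ω` deprived of the defect line, which lies along the `z`-axis. -/
def offLine (Ω : Opens Space) : Set Space := {x | x ∈ Ω ∧ planar x ≠ 0}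

/-- The classical partial derivative `∂_i f`. -/
noncomputable def pd {n : ℕ} (i : Fin n) (f : EuclideanSpace ℝ (Fin n) → ℝ) :
    EuclideanSpace ℝ (Fin n) → ℝ :=
  fun x => fderiv ℝ f x (base i)

/-- The distribution `φ ↦ ∫ φ f` on the open set `U` defined by a function `f` that is locally
integrable on `U`. -/
noncomputable def toDist {n : ℕ} (U : Opens (EuclideanSpace ℝ (Fin n)))
    (f : EuclideanSpace ℝ (Fin n) → ℝ) : 𝓓'(U, ℝ) where
  toFun φ := TestFunction.integralAgainstBilinCLM (ContinuousLinearMap.mul ℝ ℝ) volume f φ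
  map_add' φ ψ := map_add _ φ ψ
  map_smul' c φ := map_smul _ c φ
  cont := ContinuousLinearMap.continuous _

theorem toDist_apply {n : ℕ} {U : Opens (EuclideanSpace ℝ (Fin n))}
    {f : EuclideanSpace ℝ (Fin n) → ℝ} (hf : LocallyIntegrableOn f U) (φ : 𝓓(U, ℝ)) :
    toDist U f φ = ∫ x, φ x * f x :=
  TestFunction.integralAgainstBilinCLM_eq_integral hf

/-- The distribution `T` on `U` is a (signed) Radon measure: it is the difference of two positive
measures that are finite on the compact subsets of `U`. -/
def IsRadon {n : ℕ} {U : Opens (EuclideanSpace ℝ (Fin n))} (T : 𝓓'(U, ℝ)) : Prop :=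
  ∃ μ ν : Measure (EuclideanSpace ℝ (Fin n)),
    (∀ K : Set (EuclideanSpace ℝ (Fin n)), IsCompact K → K ⊆ U → μ K < ⊤ ∧ ν K < ⊤) ∧
      ∀ φ : 𝓓(U, ℝ), T φ = ∫ x, φ x ∂μ - ∫ x, φ x ∂ν

/-- The hypotheses on a 2D strain with a line defect along the `z`-axis. -/
structure IsStrain2D (Ω : Opens Space) (S : Space → Matrix (Fin 3) (Fin 3) ℝ) : Prop where
  symm : ∀ x ∈ offLine Ω, (S x).IsSymm
  smooth : ∀ i j, ContDiffOn ℝ ∞ (fun x => S x i j) (offLine Ω)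
  integrable : ∀ i j, IntegrableOn (fun x => S x i j) Ω
  indep_z : ∀ x ∈ offLine Ω, ∀ y ∈ offLine Ω, planar x = planar y → S x = S y
  compat_planar : ∀ x ∈ offLine Ω,
    ∑ α, ∑ β, ∑ γ, ∑ δ,
      eps α γ * eps β δ * pd (sp α) (pd (sp β) fun y => S y (sp γ) (sp δ)) x = 0
  compat_shear : ∃ K : ℝ, ∀ x ∈ offLine Ω,
    ∑ α, ∑ β, eps α β * pd (sp α) (fun y => S y (sp β) zi) x = K
  compat_vertical : ∃ (a : Fin 2 → ℝ) (b : ℝ), ∀ x ∈ offLine Ω,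
    S x zi zi = ∑ α, a α * x (sp α) + b

/-- The strain divergence `∂_α S_{αi}` and the gradient `∂_γ S_{κκ}` of the planar trace, taken in
the sense of distributions, are Radon measures on `Ω`. -/
structure HasRadonDivTrace (Ω : Opens Space) (S : Space → Matrix (Fin 3) (Fin 3) ℝ) : Prop where
  div : ∀ i : Fin 3,
    IsRadon (∑ α : Fin 2, ∂_{base (sp α)} (toDist Ω fun x => S x (sp α) i))
  trace : ∀ γ : Fin 2,
    IsRadon (∂_{base (sp γ)} (toDist Ω fun x => ∑ κ : Fin 2, S x (sp κ) (sp κ)))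

/-- The distributional curl `ε_{αβ} ∂_α E_β` of a planar vector field. -/
noncomputable def curl (U : Opens Plane) (E : Fin 2 → Plane → ℝ) : 𝓓'(U, ℝ) :=
  ∑ α, ∑ β, eps α β • ∂_{base α} (toDist U (E β))

/-- The distributional incompatibility `ε_{αγ} ε_{βδ} ∂_α ∂_β E_{γδ}` of a planar tensor field. -/
noncomputable def incompat (U : Opens Plane) (E : Fin 2 → Fin 2 → Plane → ℝ) : 𝓓'(U, ℝ) :=
  ∑ α, ∑ β, ∑ γ, ∑ δ, (eps α γ * eps β δ) • ∂_{base α} (∂_{base β} (toDist U (E γ δ)))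

end StrainDecomp

open StrainDecomp

/-! Being independent of z, the strain descends to a field on the projection of `Ω` to the plane,
smooth off the origin. By Fubini on small cylinders, it is locally integrable even near the origin
(`locallyIntegrableOn_planarStrain`). After rotation by the permutation symbol, the curl becomes a
divergence and the incompatibility a double divergence. Once a rigid rotation field has absorbed the
constant K, both vanish classically off the origin, so as distributions they are supported there.

A distribution that is a sum of m-th derivatives of L¹_loc functions and is supported at a point has
order less than m: a test function with vanishing (m-1)-jet can be cut off to a ball of radius R
with its m-th derivatives bounded uniformly in R, and the weight has vanishing integral over
shrinking balls (`functional_eq_zero_of_jet`). Hence the curl is a multiple of the Dirac mass δ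
(`flux_eq_mul`), and the incompatibility is a combination of δ and its first derivatives
(`flux2_eq_jet`).

Each of these sources is produced by an explicit field: the rotated x/r² gives δ for the curl; x_α
x_β/r² gives δ for the incompatibility, up to first derivatives of δ; and δ_{αβ} x_γ/r² gives ∂_γ δ.
These fields are O(r⁻¹), hence o(r⁻²). With e the matching combination (plus the rigid rotation in
the curl case), E is the remainder. -/

/-! ### Radial cut-off functions -/

/-- The profile of a radial cut-off, as a function of the squared distance to the origin. -/
noncomputable def bumpProfile (R t : ℝ) : ℝ := Real.smoothTransition (2 - 2 * (R⁻¹ ^ 2 * t))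

theorem contDiff_bumpProfile (R : ℝ) : ContDiff ℝ ∞ (bumpProfile R) :=
  Real.smoothTransition.contDiff.comp (by fun_prop)

theorem antitone_bumpProfile (R : ℝ) : Antitone (bumpProfile R) := fun s t h =>
  Real.smoothTransition.monotone (by gcongr)

section Jet

variable {V : Type*} [NormedAddCommGroup V]

/-- A smooth radial function that is `1` near the origin and vanishes off the ball of radius `R`. -/
noncomputable def bump (R : ℝ) (x : V) : ℝ := bumpProfile R (‖x‖ ^ 2)

theorem bump_eventuallyEq_one (R : ℝ) : (bump R : V → ℝ) =ᶠ[𝓝 0] fun _ => 1 := by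
  have hc : Continuous fun x : V => R⁻¹ ^ 2 * ‖x‖ ^ 2 := by fun_prop
  have h : ∀ᶠ x : V in 𝓝 0, R⁻¹ ^ 2 * ‖x‖ ^ 2 < 1 / 2 :=
    hc.continuousAt.eventually_lt continuousAt_const (by simp)
  filter_upwards [h] with x hx
  exact Real.smoothTransition.one_of_one_le (by linarith)

theorem bump_eq_zero {R : ℝ} (hR : 0 < R) {x : V} (hx : R ≤ ‖x‖) : bump R x = 0 := by
  refine Real.smoothTransition.zero_of_nonpos ?_
  have h : 1 ≤ R⁻¹ * ‖x‖ := by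
    rw [inv_mul_eq_div, le_div_iff₀ hR]; linarith
  nlinarith

theorem tsupport_bump_subset {R : ℝ} (hR : 0 < R) :
    tsupport (bump R : V → ℝ) ⊆ Metric.closedBall 0 R := by
  refine closure_minimal (fun x hx => ?_) Metric.isClosed_closedBall
  by_contra h
  rw [mem_closedBall_zero_iff, not_le] at h
  exact hx (bump_eq_zero hR h.le)

variable [InnerProductSpace ℝ V]

theorem contDiff_bump (R : ℝ) : ContDiff ℝ ∞ (bump R : V → ℝ) :=
  (contDiff_bumpProfile R).comp (contDiff_norm_sq ℝ)

/-- All cut-offs are dilations of a single one, which makes the constants in the derivative bounds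
independent of the radius. -/
theorem bump_eq_scaled (R : ℝ) : (bump R : V → ℝ) = fun x => bump 1 (R⁻¹ • x) := by
  funext x
  simp [bump, bumpProfile, norm_smul, mul_pow]

theorem hasCompactSupport_bump [FiniteDimensional ℝ V] {R : ℝ} (hR : 0 < R) :
    HasCompactSupport (bump R : V → ℝ) :=
  (isCompact_closedBall 0 R).of_isClosed_subset isClosed_closure (tsupport_bump_subset hR)

/-- The derivatives of the cut-offs scale like the powers of the inverse radius. -/
theorem exists_norm_iteratedFDeriv_bump_le [FiniteDimensional ℝ V] (n : ℕ) :
    ∃ C, 0 ≤ C ∧ ∀ R : ℝ, 0 < R → ∀ x : V, ‖iteratedFDeriv ℝ n (bump R) x‖ ≤ C * R⁻¹ ^ n := by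
  obtain ⟨C, hC⟩ := ((contDiff_bump (V := V) 1).continuous_iteratedFDeriv
    (m := n) (mod_cast le_top)).bounded_above_of_compact_support
    ((hasCompactSupport_bump one_pos).iteratedFDeriv n)
  refine ⟨C, (norm_nonneg _).trans (hC 0), fun R hR x => ?_⟩
  rw [bump_eq_scaled, iteratedFDeriv_comp_const_smul (i := n) R⁻¹
    ((contDiff_bump 1).of_le (mod_cast le_top)), norm_smul, norm_pow, Real.norm_of_nonneg
    (inv_nonneg.2 hR.le), mul_comm]
  gcongr
  exact hC _

/-! ### Functionals supported at the origin -/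

/-- `φ` is a smooth function with compact support in `U`. -/
structure IsTest (U : Set V) (φ : V → ℝ) : Prop where
  contDiff : ContDiff ℝ ∞ φ
  hasCompactSupport : HasCompactSupport φ
  tsupport_subset : tsupport φ ⊆ U

namespace IsTest

variable {U : Set V} {φ ψ : V → ℝ}

theorem mono {W : Set V} (h : IsTest U φ) (hW : U ⊆ W) : IsTest W φ :=
  ⟨h.1, h.2, h.3.trans hW⟩

theorem add (hφ : IsTest U φ) (hψ : IsTest U ψ) : IsTest U (fun x => φ x + ψ x) :=
  ⟨hφ.1.add hψ.1, hφ.2.add hψ.2, (tsupport_add φ ψ).trans (Set.union_subset hφ.3 hψ.3)⟩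

theorem mul_left (hφ : IsTest U φ) (hψ : ContDiff ℝ ∞ ψ) : IsTest U (fun x => ψ x * φ x) :=
  ⟨hψ.mul hφ.1, hφ.2.mul_left, (tsupport_mul_subset_right (f := ψ)).trans hφ.3⟩

theorem fderiv_apply (hφ : IsTest U φ) (v : V) : IsTest U (fun x => fderiv ℝ φ x v) :=
  ⟨(hφ.1.fderiv_right (m := ∞) le_rfl).clm_apply contDiff_const, hφ.2.fderiv_apply ℝ v,
    (tsupport_fderiv_apply_subset ℝ v).trans hφ.3⟩

end IsTest

theorem isTest_bump [FiniteDimensional ℝ V] {U : Set V} {R : ℝ} (hR : 0 < R)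
    (hU : Metric.closedBall 0 R ⊆ U) : IsTest U (bump R : V → ℝ) :=
  ⟨contDiff_bump R, hasCompactSupport_bump hR, (tsupport_bump_subset hR).trans hU⟩

/-- Taylor's estimate for a function whose derivatives of order less than `m` vanish at `0`. -/
theorem exists_norm_iteratedFDeriv_le_of_jet {φ : V → ℝ} (hφ : ContDiff ℝ ∞ φ)
    (hc : HasCompactSupport φ) (m : ℕ) (hj : ∀ j < m, iteratedFDeriv ℝ j φ 0 = 0) (k : ℕ)
    (hk : k ≤ m) :
    ∃ C, 0 ≤ C ∧ ∀ x, ‖iteratedFDeriv ℝ (m - k) φ x‖ ≤ C * ‖x‖ ^ k := by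
  -- Descending induction on the order of the derivative: order m is bounded by compact support, and
  -- each lower derivative vanishes at 0, so the mean value inequality on the ball of radius `‖x‖`
  -- gains one factor `‖x‖`.
  induction k with
  | zero =>
    obtain ⟨C, hC⟩ := (hφ.continuous_iteratedFDeriv
      (m := m) (mod_cast le_top)).bounded_above_of_compact_support (hc.iteratedFDeriv m)
    exact ⟨C, (norm_nonneg _).trans (hC 0), fun x => by simpa using hC x⟩
  | succ k ih =>
    obtain ⟨C, hC0, hC⟩ := ih (by lia)
    refine ⟨C, hC0, fun x => ?_⟩
    obtain ⟨n, hn⟩ : ∃ n, n = m - (k + 1) := ⟨_, rfl⟩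
    have hn' : m - k = n + 1 := by lia
    rw [← hn]
    rw [hn'] at hC
    have h := (convex_closedBall (0 : V) ‖x‖).norm_image_sub_le_of_norm_fderiv_le (𝕜 := ℝ)
      (f := iteratedFDeriv ℝ n φ) (C := C * ‖x‖ ^ k) (x := 0) (y := x)
      (fun y _ => (hφ.differentiable_iteratedFDeriv (m := n) (mod_cast ENat.natCast_lt_top n)) y)
      (fun y hy => by
        rw [norm_fderiv_iteratedFDeriv]
        refine (hC y).trans ?_
        have := mem_closedBall_zero_iff.1 hy
        gcongr)
      (by simp) (by simp)
    rw [hj n (by lia), sub_zero, sub_zero] at h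
    rw [pow_succ, ← mul_assoc]
    exact h

/-- Cutting off a function with vanishing jet does not increase its top derivative. -/
theorem exists_norm_iteratedFDeriv_mul_bump_le [FiniteDimensional ℝ V] {φ : V → ℝ}
    (hφ : ContDiff ℝ ∞ φ) (hc : HasCompactSupport φ) (m : ℕ)
    (hj : ∀ j < m, iteratedFDeriv ℝ j φ 0 = 0) :
    ∃ C, 0 ≤ C ∧ ∀ R : ℝ, 0 < R → ∀ x,
      ‖iteratedFDeriv ℝ m (fun y => bump R y * φ y) x‖ ≤
        (Metric.closedBall (0 : V) R).indicator (fun _ => C) x := by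
  choose! A hA0 hA using exists_norm_iteratedFDeriv_le_of_jet hφ hc m hj
  choose B hB0 hB using exists_norm_iteratedFDeriv_bump_le (V := V)
  have hC0 : 0 ≤ ∑ i ∈ Finset.range (m + 1), (m.choose i : ℝ) * B i * A i :=
    Finset.sum_nonneg fun i hi => by
      have := hA0 i (by simp at hi; lia)
      have := hB0 i
      positivity
  refine ⟨_, hC0, fun R hR x => ?_⟩
  by_cases hx : x ∈ Metric.closedBall (0 : V) R
  · rw [Set.indicator_of_mem hx]
    rw [mem_closedBall_zero_iff] at hx
    refine (norm_iteratedFDeriv_mul_le (contDiff_bump R) hφ x (n := m)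
      (mod_cast le_top)).trans (Finset.sum_le_sum fun i hi => ?_)
    have him : i ≤ m := by simp at hi; lia
    have hAi := hA0 i him
    have hBi := hB0 i
    -- In each Leibniz term the loss R⁻ⁱ from the cut-off is compensated by the Taylor gain ‖x‖ⁱ ≤
    -- Rⁱ.
    calc (m.choose i : ℝ) * ‖iteratedFDeriv ℝ i (bump R) x‖ * ‖iteratedFDeriv ℝ (m - i) φ x‖
        ≤ (m.choose i : ℝ) * (B i * R⁻¹ ^ i) * (A i * R ^ i) := by
          gcongr
          · exact hB i R hR x
          · exact (hA i him x).trans (by gcongr)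
      _ = (m.choose i : ℝ) * B i * A i := by
          rw [inv_pow]
          field_simp
  · rw [Set.indicator_of_notMem hx, image_eq_zero_of_notMem_tsupport
      (f := iteratedFDeriv ℝ m fun y => bump R y * φ y), norm_zero]
    exact fun h => hx (tsupport_bump_subset hR
      (tsupport_mul_subset_left (tsupport_iteratedFDeriv_subset m h)))

/-- A functional that is supported at the origin and is controlled by the derivatives of order `m`
with a locally integrable weight vanishes on the functions with vanishing jet of order `m - 1`. -/
theorem functional_eq_zero_of_jet [FiniteDimensional ℝ V] [MeasurableSpace V] [BorelSpace V]
    {μ : Measure V} [NullSingletonClass μ] {U : Set V} (hU : IsOpen U) {m : ℕ} {T : (V → ℝ) → ℝ} {g : V → ℝ}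
    (hg : LocallyIntegrableOn g U μ) (hg0 : 0 ≤ g)
    (hadd : ∀ φ ψ, IsTest U φ → IsTest U ψ → T (fun x => φ x + ψ x) = T φ + T ψ)
    (hsupp : ∀ φ, IsTest U φ → 0 ∉ tsupport φ → T φ = 0)
    (hbound : ∀ φ, IsTest U φ → ‖T φ‖ ≤ ∫ x, g x * ‖iteratedFDeriv ℝ m φ x‖ ∂μ)
    {φ : V → ℝ} (hφ : IsTest U φ) (hj : ∀ j < m, iteratedFDeriv ℝ j φ 0 = 0) : T φ = 0 := by
  by_cases h0 : (0 : V) ∈ U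
  swap
  · exact hsupp φ hφ fun h => h0 (hφ.3 h)
  obtain ⟨R, hR, hRU⟩ := Metric.nhds_basis_closedBall.mem_iff.1 (hU.mem_nhds h0)
  -- The complementary piece `(1 - bump r) * φ` vanishes near the origin, so `T` kills it whatever
  -- the radius.
  have hcut : ∀ r : ℝ, 0 < r → T φ = T (fun x => bump r x * φ x) := by
    intro r hr
    have h1 : IsTest U fun x => bump r x * φ x := hφ.mul_left (contDiff_bump r)
    have h2 : IsTest U fun x => (1 - bump r x) * φ x :=
      hφ.mul_left (contDiff_const.sub (contDiff_bump r))
    have h3 := hadd _ _ h1 h2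
    rw [hsupp _ h2, add_zero] at h3
    · rw [← h3]
      congr 1
      funext x
      ring
    · rw [notMem_tsupport_iff_eventuallyEq]
      filter_upwards [bump_eventuallyEq_one r] with x hx
      simp [hx]
  obtain ⟨C, hC0, hC⟩ := exists_norm_iteratedFDeriv_mul_bump_le hφ.1 hφ.2 m hj
  let r : ℕ → ℝ := fun n => R / (n + 1)
  have hr : ∀ n, 0 < r n := fun n => by positivity
  have hr_anti : Antitone r := fun i j hij => by
    simp only [r]
    gcongr
  have hr_lim : Tendsto r atTop (𝓝 0) := tendsto_const_div_atTop_nhds_zero_nat R |>.comp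
    (tendsto_add_atTop_nat 1) |>.congr fun n => by simp [r]
  have hint : IntegrableOn g (Metric.closedBall 0 R) μ :=
    hg.integrableOn_compact_subset hRU (isCompact_closedBall 0 R)
  have hr_le : ∀ n, r n ≤ R := fun n => by simpa [r] using hr_anti (Nat.zero_le n)
  have hle : ∀ n, ‖T φ‖ ≤ C * ∫ x in Metric.closedBall 0 (r n), g x ∂μ := by
    intro n
    rw [hcut (r n) (hr n), ← integral_const_mul, ← integral_indicator
      Metric.isClosed_closedBall.measurableSet]
    refine (hbound _ (hφ.mul_left (contDiff_bump _))).trans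
      (integral_mono_of_nonneg (.of_forall fun x => mul_nonneg (hg0 x) (norm_nonneg _)) ?_
        (.of_forall fun x => ?_))
    · rw [integrable_indicator_iff Metric.isClosed_closedBall.measurableSet]
      exact (hint.mono_set (Metric.closedBall_subset_closedBall (hr_le n))).const_mul C
    · refine (mul_le_mul_of_nonneg_left (hC (r n) (hr n) x) (hg0 x)).trans_eq ?_
      by_cases hx : x ∈ Metric.closedBall (0 : V) (r n) <;> simp [hx, mul_comm]
  -- The balls decrease to the null set {0}, so the integrals of the fixed integrable weight tend to
  -- 0.
  have hlim := tendsto_setIntegral_of_antitone (μ := μ) (f := g)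
    (s := fun n => Metric.closedBall (0 : V) (r n))
    (fun n => Metric.isClosed_closedBall.measurableSet)
    (fun i j hij => Metric.closedBall_subset_closedBall (hr_anti hij))
    ⟨0, hint.mono_set (Metric.closedBall_subset_closedBall (hr_le 0))⟩
  have hinter : ⋂ n, Metric.closedBall (0 : V) (r n) = {0} := by
    ext x
    simp only [Set.mem_iInter, mem_closedBall_zero_iff, Set.mem_singleton_iff]
    refine ⟨fun h => norm_le_zero_iff.1 (ge_of_tendsto' hr_lim h), fun h n => ?_⟩
    simpa [h] using (hr n).le
  rw [hinter, Measure.restrict_singleton, measure_singleton, zero_smul,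
    integral_zero_measure] at hlim
  have := ge_of_tendsto' (hlim.const_mul C) hle
  rw [mul_zero] at this
  exact norm_le_zero_iff.1 this

end Jet

/-! ### Integration against planar test functions -/

section General

variable {n : ℕ} {U : Set (EuclideanSpace ℝ (Fin n))} {f φ ψ : EuclideanSpace ℝ (Fin n) → ℝ}

theorem MeasureTheory.LocallyIntegrableOn.integrable_mul_of_tsupport_subset
    (hf : LocallyIntegrableOn f U) (hφ : Continuous φ) (hc : HasCompactSupport φ)
    (hφU : tsupport φ ⊆ U) : Integrable fun x => f x * φ x := by
  have h : IntegrableOn (fun x => f x * φ x) (tsupport φ) :=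
    (hf.integrableOn_compact_subset hφU hc).mul_continuousOn hφ.continuousOn hc
  rwa [integrableOn_iff_integrable_of_support_subset] at h
  exact (Function.support_mul_subset_right _ _).trans (subset_tsupport φ)

theorem locallyIntegrableOn_finsetSum {ι : Type*} (s : Finset ι)
    {F : ι → EuclideanSpace ℝ (Fin n) → ℝ} (hF : ∀ i ∈ s, LocallyIntegrableOn (F i) U) :
    LocallyIntegrableOn (fun x => ∑ i ∈ s, F i x) U := by
  classical
  induction s using Finset.induction_on with
  | empty => simpa using locallyIntegrableOn_zero
  | insert i s hi ih =>
    simp only [Finset.sum_insert hi]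
    exact (hF i (by simp)).add (ih fun j hj => hF j (by simp [hj]))

theorem IsTest.pd (hφ : IsTest U φ) (i : Fin n) : IsTest U (pd i φ) := hφ.fderiv_apply _

theorem IsTest.integrable_mul (hφ : IsTest U φ) (hf : LocallyIntegrableOn f U) :
    Integrable fun x => f x * φ x :=
  hf.integrable_mul_of_tsupport_subset hφ.1.continuous hφ.2 hφ.3

theorem ContDiffOn.pd (hU : IsOpen U) (hf : ContDiffOn ℝ ∞ f U) (i : Fin n) :
    ContDiffOn ℝ ∞ (pd i f) U :=
  (hf.fderiv_of_isOpen hU (m := ∞) le_rfl).clm_apply contDiffOn_const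

theorem ContDiffOn.differentiableAt_of_isOpen (hU : IsOpen U) (hf : ContDiffOn ℝ ∞ f U)
    {x : EuclideanSpace ℝ (Fin n)} (hx : x ∈ U) : DifferentiableAt ℝ f x :=
  (hf.contDiffAt (hU.mem_nhds hx)).differentiableAt (by simp)

theorem ContDiffOn.locallyIntegrableOn_of_isOpen (hU : IsOpen U) (hf : ContDiffOn ℝ ∞ f U) :
    LocallyIntegrableOn f U :=
  hf.continuousOn.locallyIntegrableOn hU.measurableSet

/-- Regularity of `f` matters only on the support of `φ`; this allows fields singular at the origin,
tested on the punctured domain. -/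
theorem integral_mul_pd_eq_neg (hU : IsOpen U) (hf : ContDiffOn ℝ ∞ f U) (hφ : IsTest U φ)
    (i : Fin n) : ∫ x, f x * pd i φ x = -∫ x, pd i f x * φ x := by
  refine integral_mul_fderiv_eq_neg_fderiv_mul_of_integrable ?_ ?_ ?_
    (fun x hx => hf.differentiableAt_of_isOpen hU (hφ.3 hx))
    (fun x _ => hφ.1.differentiable (by simp) x)
  · exact hφ.integrable_mul ((hf.pd hU i).locallyIntegrableOn_of_isOpen hU)
  · exact (hφ.pd i).integrable_mul (hf.locallyIntegrableOn_of_isOpen hU)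
  · exact hφ.integrable_mul (hf.locallyIntegrableOn_of_isOpen hU)

theorem pd_add (hφ : ContDiff ℝ ∞ φ) (hψ : ContDiff ℝ ∞ ψ) (i : Fin n) :
    pd i (fun x => φ x + ψ x) = fun x => pd i φ x + pd i ψ x := by
  funext x
  have := fderiv_fun_add (hφ.differentiable (by simp) x) (hψ.differentiable (by simp) x)
  simp [StrainDecomp.pd, this]

theorem pd_const_mul (hφ : ContDiff ℝ ∞ φ) (c : ℝ) (i : Fin n) :
    pd i (fun x => c * φ x) = fun x => c * pd i φ x := by
  funext x
  simp only [StrainDecomp.pd]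
  rw [fderiv_const_mul (hφ.differentiable (by simp) x)]
  rfl

theorem abs_pd_le (φ : EuclideanSpace ℝ (Fin n) → ℝ) (i : Fin n) (x : EuclideanSpace ℝ (Fin n)) :
    |pd i φ x| ≤ ‖iteratedFDeriv ℝ 1 φ x‖ := by
  rw [norm_iteratedFDeriv_one]
  simpa [StrainDecomp.pd] using (fderiv ℝ φ x).le_opNorm (base i)

theorem abs_pd_pd_le (hφ : ContDiff ℝ ∞ φ) (i j : Fin n) (x : EuclideanSpace ℝ (Fin n)) :
    |pd i (pd j φ) x| ≤ ‖iteratedFDeriv ℝ 2 φ x‖ := by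
  have h1 : DifferentiableAt ℝ (fderiv ℝ φ) x :=
    (hφ.fderiv_right (m := ∞) le_rfl).differentiable (by simp) x
  have h : pd i (pd j φ) x = iteratedFDeriv ℝ 2 φ x ![base i, base j] := by
    rw [iteratedFDeriv_two_apply]
    unfold StrainDecomp.pd
    rw [fderiv_clm_apply h1 (differentiableAt_const _)]
    simp
  rw [h]
  simpa using (iteratedFDeriv ℝ 2 φ x).le_opNorm ![base i, base j]

theorem IsTest.of_notMem_tsupport (hφ : IsTest U φ) (h0 : 0 ∉ tsupport φ) : IsTest (U \ {0}) φ :=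
  ⟨hφ.1, hφ.2, fun _ hx => ⟨hφ.3 hx, fun h => h0 (h ▸ hx)⟩⟩

end General

/-- The pairing `∫ A_α ∂_α φ`. -/
noncomputable def flux (A : Fin 2 → Plane → ℝ) (φ : Plane → ℝ) : ℝ :=
  ∫ x, ∑ α, A α x * pd α φ x

/-- The pairing `∫ A_{αβ} ∂_β ∂_α φ`. -/
noncomputable def flux2 (A : Fin 2 → Fin 2 → Plane → ℝ) (φ : Plane → ℝ) : ℝ :=
  ∫ x, ∑ α, ∑ β, A α β x * pd β (pd α φ) x

/-! ### First-order pairings and the Dirac mass -/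

section Flux

variable {U : Set Plane} {φ ψ η : Plane → ℝ} {A B : Fin 2 → Plane → ℝ}

theorem integrable_flux (hA : ∀ α, LocallyIntegrableOn (A α) U) (hφ : IsTest U φ) :
    Integrable fun x => ∑ α, A α x * pd α φ x :=
  integrable_finsetSum _ fun α _ => (hφ.pd α).integrable_mul (hA α)

theorem flux_eq_sum (hA : ∀ α, LocallyIntegrableOn (A α) U) (hφ : IsTest U φ) :
    flux A φ = ∑ α, ∫ x, A α x * pd α φ x :=
  integral_finsetSum _ fun α _ => (hφ.pd α).integrable_mul (hA α)

theorem flux_add (hA : ∀ α, LocallyIntegrableOn (A α) U) (hφ : IsTest U φ) (hψ : IsTest U ψ) :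
    flux A (fun x => φ x + ψ x) = flux A φ + flux A ψ := by
  unfold flux
  rw [← integral_add (integrable_flux hA hφ) (integrable_flux hA hψ)]
  simp only [pd_add hφ.1 hψ.1, mul_add, Finset.sum_add_distrib]

theorem flux_const_mul (A : Fin 2 → Plane → ℝ) (c : ℝ) (hφ : IsTest U φ) :
    flux A (fun x => c * φ x) = c * flux A φ := by
  unfold flux
  rw [← integral_const_mul]
  simp only [pd_const_mul hφ.1, Finset.mul_sum, mul_left_comm]

theorem flux_sub_const_mul (hA : ∀ α, LocallyIntegrableOn (A α) U)
    (hB : ∀ α, LocallyIntegrableOn (B α) U) (c : ℝ) (hφ : IsTest U φ) :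
    flux (fun α x => A α x - c * B α x) φ = flux A φ - c * flux B φ := by
  unfold flux
  rw [← integral_const_mul,
    ← integral_sub (integrable_flux hA hφ) ((integrable_flux hB hφ).const_mul c)]
  simp only [sub_mul, Finset.sum_sub_distrib, Finset.mul_sum, mul_assoc]

/-- The divergence theorem for a solenoidal field. -/
theorem flux_eq_zero (hU : IsOpen U) (hA : ∀ α, ContDiffOn ℝ ∞ (A α) U)
    (hdiv : ∀ x ∈ U, ∑ α, pd α (A α) x = 0) (hφ : IsTest U φ) : flux A φ = 0 := by
  rw [flux_eq_sum (fun α => (hA α).locallyIntegrableOn_of_isOpen hU) hφ]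
  simp only [integral_mul_pd_eq_neg hU (hA _) hφ]
  rw [Finset.sum_neg_distrib, ← integral_finsetSum _ fun α _ =>
    hφ.integrable_mul (((hA α).pd hU α).locallyIntegrableOn_of_isOpen hU), neg_eq_zero]
  refine integral_eq_zero_of_ae (.of_forall fun x => ?_)
  simp only [← Finset.sum_mul, Pi.zero_apply]
  by_cases hx : x ∈ tsupport φ
  · rw [hdiv x (hφ.3 hx), zero_mul]
  · rw [image_eq_zero_of_notMem_tsupport hx, mul_zero]

/-- The flux of a locally integrable field that is solenoidal off the origin is a multiple of the
value at the origin. -/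
theorem flux_eq_mul (hU : IsOpen U) (hA : ∀ α, LocallyIntegrableOn (A α) U)
    (hA' : ∀ α, ContDiffOn ℝ ∞ (A α) (U \ {0}))
    (hdiv : ∀ x ∈ U \ {0}, ∑ α, pd α (A α) x = 0) (hη : IsTest U η) (hη1 : η =ᶠ[𝓝 0] fun _ => 1)
    (hφ : IsTest U φ) : flux A φ = φ 0 * flux A η := by
  have h1 : IsTest U fun x => -φ 0 * η x := hη.mul_left contDiff_const
  -- Subtracting `φ 0 * η` removes the value at 0, and the flux is bounded by first derivatives with
  -- an L¹_loc weight: the case m = 1 of the jet lemma.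
  have key : flux A (fun x => φ x + -φ 0 * η x) = 0 := by
    refine functional_eq_zero_of_jet (μ := volume) hU (m := 1) (T := flux A)
      (g := fun x => ∑ α, |A α x|) (locallyIntegrableOn_finsetSum _ fun α _ => (hA α).norm)
      (fun _ => Finset.sum_nonneg fun α _ => abs_nonneg _)
      (fun φ ψ hφ hψ => flux_add hA hφ hψ)
      (fun φ hφ h0 => flux_eq_zero (hU.sdiff isClosed_singleton) hA' hdiv
        (hφ.of_notMem_tsupport h0)) (fun φ hφ => ?_) (hφ.add h1) (fun j hj => ?_)
    · refine norm_integral_le_of_norm_le ?_ (.of_forall fun x => ?_)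
      · refine LocallyIntegrableOn.integrable_mul_of_tsupport_subset
          (locallyIntegrableOn_finsetSum _ fun α _ => (hA α).norm) ?_ ?_ ?_ (U := U)
        · exact (hφ.1.continuous_iteratedFDeriv (m := 1) (mod_cast le_top)).norm
        · exact (hφ.2.iteratedFDeriv 1).norm
        · exact (closure_mono (Function.support_comp_subset norm_zero _)).trans
            ((tsupport_iteratedFDeriv_subset 1).trans hφ.3)
      · rw [Finset.sum_mul]
        refine (Finset.abs_sum_le_sum_abs _ _).trans (Finset.sum_le_sum fun α _ => ?_)
        rw [abs_mul]
        gcongr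
        exact abs_pd_le φ α x
    · obtain rfl : j = 0 := by lia
      rw [← norm_eq_zero, norm_iteratedFDeriv_zero]
      simp [hη1.eq_of_nhds]
  rw [flux_add hA hφ h1, flux_const_mul A _ hη] at key
  linarith

end Flux

/-! ### Second-order pairings and the first derivatives of the Dirac mass -/

section FluxTwo

variable {U : Set Plane} {φ ψ η : Plane → ℝ} {A B : Fin 2 → Fin 2 → Plane → ℝ}

theorem integrable_flux2 (hA : ∀ α β, LocallyIntegrableOn (A α β) U) (hφ : IsTest U φ) :
    Integrable fun x => ∑ α, ∑ β, A α β x * pd β (pd α φ) x :=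
  integrable_finsetSum _ fun α _ => integrable_finsetSum _ fun β _ =>
    ((hφ.pd α).pd β).integrable_mul (hA α β)

theorem flux2_eq_sum (hA : ∀ α β, LocallyIntegrableOn (A α β) U) (hφ : IsTest U φ) :
    flux2 A φ = ∑ α, ∑ β, ∫ x, A α β x * pd β (pd α φ) x := by
  have h : ∀ α β, Integrable fun x => A α β x * pd β (pd α φ) x := fun α β =>
    ((hφ.pd α).pd β).integrable_mul (hA α β)
  unfold flux2
  rw [integral_finsetSum _ fun α _ => integrable_finsetSum _ fun β _ => h α β]
  exact Finset.sum_congr rfl fun α _ => integral_finsetSum _ fun β _ => h α β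

theorem flux2_add (hA : ∀ α β, LocallyIntegrableOn (A α β) U) (hφ : IsTest U φ)
    (hψ : IsTest U ψ) : flux2 A (fun x => φ x + ψ x) = flux2 A φ + flux2 A ψ := by
  unfold flux2
  rw [← integral_add (integrable_flux2 hA hφ) (integrable_flux2 hA hψ)]
  simp only [pd_add hφ.1 hψ.1, pd_add (hφ.pd _).1 (hψ.pd _).1, mul_add, Finset.sum_add_distrib]

theorem flux2_const_mul (A : Fin 2 → Fin 2 → Plane → ℝ) (c : ℝ) (hφ : IsTest U φ) :
    flux2 A (fun x => c * φ x) = c * flux2 A φ := by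
  unfold flux2
  rw [← integral_const_mul]
  simp only [pd_const_mul hφ.1, pd_const_mul (hφ.pd _).1, Finset.mul_sum, mul_left_comm]

theorem flux2_sub_const_mul (hA : ∀ α β, LocallyIntegrableOn (A α β) U)
    (hB : ∀ α β, LocallyIntegrableOn (B α β) U) (c : ℝ) (hφ : IsTest U φ) :
    flux2 (fun α β x => A α β x - c * B α β x) φ = flux2 A φ - c * flux2 B φ := by
  unfold flux2
  rw [← integral_const_mul,
    ← integral_sub (integrable_flux2 hA hφ) ((integrable_flux2 hB hφ).const_mul c)]
  simp only [sub_mul, Finset.sum_sub_distrib, Finset.mul_sum, mul_assoc]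

theorem flux2_eq_zero (hU : IsOpen U) (hA : ∀ α β, ContDiffOn ℝ ∞ (A α β) U)
    (hdiv : ∀ x ∈ U, ∑ α, ∑ β, pd α (pd β (A α β)) x = 0) (hφ : IsTest U φ) :
    flux2 A φ = 0 := by
  have h : ∀ α β, Integrable fun x => pd α (pd β (A α β)) x * φ x := fun α β =>
    hφ.integrable_mul ((((hA α β).pd hU β).pd hU α).locallyIntegrableOn_of_isOpen hU)
  rw [flux2_eq_sum (fun α β => (hA α β).locallyIntegrableOn_of_isOpen hU) hφ]
  -- The outer derivative β moves first, then α, which yields the order of derivatives in `hdiv`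
  -- without any interchange.
  simp only [integral_mul_pd_eq_neg hU (hA _ _) (hφ.pd _),
    integral_mul_pd_eq_neg hU ((hA _ _).pd hU _) hφ, neg_neg]
  simp_rw [← integral_finsetSum _ fun β _ => h _ β]
  rw [← integral_finsetSum _ fun α _ => integrable_finsetSum _ fun β _ => h α β]
  refine integral_eq_zero_of_ae (.of_forall fun x => ?_)
  simp only [← Finset.sum_mul, Pi.zero_apply]
  by_cases hx : x ∈ tsupport φ
  · rw [hdiv x (hφ.3 hx), zero_mul]
  · rw [image_eq_zero_of_notMem_tsupport hx, mul_zero]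

/-- The pairing with second derivatives of a locally integrable field whose double divergence
vanishes off the origin depends only on the jet of order one at the origin. -/
theorem flux2_eq_jet (hU : IsOpen U) (hA : ∀ α β, LocallyIntegrableOn (A α β) U)
    (hA' : ∀ α β, ContDiffOn ℝ ∞ (A α β) (U \ {0}))
    (hdiv : ∀ x ∈ U \ {0}, ∑ α, ∑ β, pd α (pd β (A α β)) x = 0) (hη : IsTest U η)
    (hη1 : η =ᶠ[𝓝 0] fun _ => 1) (hφ : IsTest U φ) :
    flux2 A φ = φ 0 * flux2 A η + ∑ γ, pd γ φ 0 * flux2 A (fun x => x γ * η x) := by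
  have hx : ∀ γ : Fin 2, IsTest U fun x => x γ * η x := fun γ =>
    hη.mul_left (EuclideanSpace.proj (𝕜 := ℝ) γ).contDiff
  have h1 : IsTest U fun x => -φ 0 * η x := hη.mul_left contDiff_const
  have h2 : ∀ γ : Fin 2, IsTest U fun x => -pd γ φ 0 * (x γ * η x) := fun γ =>
    (hx γ).mul_left contDiff_const
  have h3 := (hφ.add h1).add ((h2 0).add (h2 1))
  -- The first-order Taylor polynomial, localized by `η`, is subtracted so that the 1-jet vanishes.
  -- Since `η` is 1 near 0, it does not disturb the jet.
  have key : flux2 A (fun x => (φ x + -φ 0 * η x) + (-pd 0 φ 0 * (x 0 * η x) +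
      -pd 1 φ 0 * (x 1 * η x))) = 0 := by
    refine functional_eq_zero_of_jet (μ := volume) hU (m := 2) (T := flux2 A)
      (g := fun x => ∑ α, ∑ β, |A α β x|)
      (locallyIntegrableOn_finsetSum _ fun α _ => locallyIntegrableOn_finsetSum _ fun β _ =>
        (hA α β).norm)
      (fun _ => Finset.sum_nonneg fun α _ => Finset.sum_nonneg fun β _ => abs_nonneg _)
      (fun φ ψ hφ hψ => flux2_add hA hφ hψ)
      (fun φ hφ h0 => flux2_eq_zero (hU.sdiff isClosed_singleton) hA' hdiv
        (hφ.of_notMem_tsupport h0)) (fun φ hφ => ?_) h3 (fun j hj => ?_)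
    · refine norm_integral_le_of_norm_le ?_ (.of_forall fun x => ?_)
      · refine LocallyIntegrableOn.integrable_mul_of_tsupport_subset
          (locallyIntegrableOn_finsetSum _ fun α _ => locallyIntegrableOn_finsetSum _ fun β _ =>
            (hA α β).norm) ?_ ?_ ?_ (U := U)
        · exact (contDiff_infty.1 hφ.1 2).continuous_iteratedFDeriv'.norm
        · exact (hφ.2.iteratedFDeriv 2).norm
        · exact (closure_mono (Function.support_comp_subset norm_zero _)).trans
            ((tsupport_iteratedFDeriv_subset 2).trans hφ.3)
      · simp only [Finset.sum_mul]
        refine (Finset.abs_sum_le_sum_abs _ _).trans (Finset.sum_le_sum fun α _ =>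
          (Finset.abs_sum_le_sum_abs _ _).trans (Finset.sum_le_sum fun β _ => ?_))
        rw [abs_mul]
        gcongr
        exact abs_pd_pd_le hφ.1 β α x
    · have hη0 : η 0 = 1 := hη1.eq_of_nhds
      interval_cases j
      · rw [← norm_eq_zero, norm_iteratedFDeriv_zero]
        simp [hη0]
      · rw [← norm_eq_zero, norm_iteratedFDeriv_one, norm_eq_zero]
        have hloc : (fun x => (φ x + -φ 0 * η x) + (-pd 0 φ 0 * (x 0 * η x) +
            -pd 1 φ 0 * (x 1 * η x))) =ᶠ[𝓝 0] fun x => (φ x + -φ 0) +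
            (-pd 0 φ 0 * EuclideanSpace.proj (𝕜 := ℝ) (0 : Fin 2) x +
              -pd 1 φ 0 * EuclideanSpace.proj (𝕜 := ℝ) (1 : Fin 2) x) := by
          filter_upwards [hη1] with x hx
          simp [hx]
        have hd := (((hφ.1.differentiable (by simp) 0).hasFDerivAt.add_const (-φ 0)).add
          (((EuclideanSpace.proj (𝕜 := ℝ) (0 : Fin 2)).hasFDerivAt.const_mul (-pd 0 φ 0)).add
          ((EuclideanSpace.proj (𝕜 := ℝ) (1 : Fin 2)).hasFDerivAt.const_mul (-pd 1 φ 0))))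
        rw [hloc.fderiv_eq]
        refine (HasFDerivAt.fderiv hd).trans ?_
        refine ContinuousLinearMap.coe_injective
          ((EuclideanSpace.basisFun (Fin 2) ℝ).toBasis.ext fun i => ?_)
        fin_cases i <;> simp [StrainDecomp.pd]
  rw [flux2_add hA (hφ.add h1) ((h2 0).add (h2 1)), flux2_add hA hφ h1, flux2_add hA (h2 0) (h2 1),
    flux2_const_mul A _ hη, flux2_const_mul A _ (hx 0), flux2_const_mul A _ (hx 1)] at key
  rw [Fin.sum_univ_two]
  linarith

end FluxTwo

/-! ### Derivatives of elementary functions -/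

section Derivatives

variable {n : ℕ} {f g : EuclideanSpace ℝ (Fin n) → ℝ} {x : EuclideanSpace ℝ (Fin n)}

theorem hasFDerivAt_norm_sq (x : EuclideanSpace ℝ (Fin n)) :
    HasFDerivAt (fun y : EuclideanSpace ℝ (Fin n) => ‖y‖ ^ 2) (2 • innerSL ℝ x) x :=
  (hasStrictFDerivAt_norm_sq x).hasFDerivAt

theorem pd_coord (i j : Fin n) (x : EuclideanSpace ℝ (Fin n)) :
    pd i (fun y => y j) x = if j = i then 1 else 0 := by
  have h : HasFDerivAt (fun y : EuclideanSpace ℝ (Fin n) => y j)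
    (EuclideanSpace.proj (𝕜 := ℝ) j) x := (EuclideanSpace.proj (𝕜 := ℝ) j).hasFDerivAt
  simp [pd, h.fderiv]

theorem pd_neg (f : EuclideanSpace ℝ (Fin n) → ℝ) (i : Fin n) (x : EuclideanSpace ℝ (Fin n)) :
    pd i (fun y => -f y) x = -pd i f x := by
  simp only [pd]
  rw [fderiv_fun_neg]
  rfl

theorem pd_add_apply (hf : DifferentiableAt ℝ f x) (hg : DifferentiableAt ℝ g x) (i : Fin n) :
    pd i (fun y => f y + g y) x = pd i f x + pd i g x := by
  simp [pd, fderiv_fun_add hf hg]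

theorem pd_sub_apply (hf : DifferentiableAt ℝ f x) (hg : DifferentiableAt ℝ g x) (i : Fin n) :
    pd i (fun y => f y - g y) x = pd i f x - pd i g x := by
  simp [pd, fderiv_fun_sub hf hg]

theorem pd_const_mul_apply (hf : DifferentiableAt ℝ f x) (c : ℝ) (i : Fin n) :
    pd i (fun y => c * f y) x = c * pd i f x := by
  simp [pd, fderiv_const_mul hf]

theorem pd_mul_apply (hf : DifferentiableAt ℝ f x) (hg : DifferentiableAt ℝ g x) (i : Fin n) :
    pd i (fun y => f y * g y) x = pd i f x * g x + f x * pd i g x := by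
  simp [pd, fderiv_fun_mul hf hg]
  ring

theorem pd_comp_norm_sq {h : ℝ → ℝ} (hh : DifferentiableAt ℝ h (‖x‖ ^ 2)) (i : Fin n) :
    pd i (fun y => h (‖y‖ ^ 2)) x = 2 * x i * deriv h (‖x‖ ^ 2) := by
  have := hh.hasDerivAt.comp_hasFDerivAt x (hasFDerivAt_norm_sq x)
  simp only [pd]
  rw [show (fun y : EuclideanSpace ℝ (Fin n) => h (‖y‖ ^ 2)) = h ∘ fun y => ‖y‖ ^ 2 from rfl,
    this.fderiv]
  have hi : inner ℝ x (base i) = x i := by simp [EuclideanSpace.inner_single_right]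
  simp [hi]
  ring

theorem pd_div_norm_sq (hf : DifferentiableAt ℝ f x) (hx : x ≠ 0) (i : Fin n) :
    pd i (fun y => f y / ‖y‖ ^ 2) x =
      (pd i f x * ‖x‖ ^ 2 - f x * (2 * x i)) / (‖x‖ ^ 2) ^ 2 := by
  have hx' : ‖x‖ ^ 2 ≠ 0 := by simpa using hx
  have h1 : DifferentiableAt ℝ (fun t : ℝ => t⁻¹) (‖x‖ ^ 2) := differentiableAt_inv hx'
  have h2 : DifferentiableAt ℝ (fun y : EuclideanSpace ℝ (Fin n) => (‖y‖ ^ 2)⁻¹) x :=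
    h1.comp x (hasFDerivAt_norm_sq x).differentiableAt
  simp only [div_eq_mul_inv]
  rw [pd_mul_apply hf h2, pd_comp_norm_sq (h := fun t => t⁻¹) h1, deriv_inv]
  field_simp
  ring

theorem pd_congr (h : f =ᶠ[𝓝 x] g) (i : Fin n) : pd i f =ᶠ[𝓝 x] pd i g := by
  filter_upwards [h.fderiv (𝕜 := ℝ)] with y hy
  simp [pd, hy]

theorem pd_comm (hf : ContDiff ℝ ∞ f) (i j : Fin n) : pd i (pd j f) = pd j (pd i f) := by
  funext x
  have h1 : DifferentiableAt ℝ (fderiv ℝ f) x :=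
    (hf.fderiv_right (m := ∞) le_rfl).differentiable (by simp) x
  have hs : IsSymmSndFDerivAt ℝ f x := (contDiff_infty.1 hf 2).contDiffAt.isSymmSndFDerivAt (by simp)
  unfold pd
  rw [fderiv_clm_apply h1 (differentiableAt_const _), fderiv_clm_apply h1 (differentiableAt_const _)]
  simpa using hs.eq (base i) (base j)

theorem differentiableAt_coord (j : Fin n) (x : EuclideanSpace ℝ (Fin n)) :
    DifferentiableAt ℝ (fun y : EuclideanSpace ℝ (Fin n) => y j) x :=
  (EuclideanSpace.proj (𝕜 := ℝ) j).differentiableAt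

theorem contDiff_coord (j : Fin n) :
    ContDiff ℝ ∞ (fun y : EuclideanSpace ℝ (Fin n) => y j) :=
  (EuclideanSpace.proj (𝕜 := ℝ) j).contDiff

end Derivatives

/-! ### The radial cut-off in the plane -/

theorem deriv_bumpProfile_nonpos (R t : ℝ) : deriv (bumpProfile R) t ≤ 0 :=
  (antitone_bumpProfile R).deriv_nonpos

theorem differentiable_bumpProfile (R : ℝ) : Differentiable ℝ (bumpProfile R) :=
  (contDiff_bumpProfile R).differentiable (by simp)

theorem contDiff_deriv_bumpProfile (R : ℝ) : ContDiff ℝ ∞ (deriv (bumpProfile R)) :=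
  ((contDiff_infty_iff_deriv (𝕜 := ℝ)).1 (contDiff_bumpProfile R)).2

theorem norm_sq_plane (x : Plane) : ‖x‖ ^ 2 = x 0 ^ 2 + x 1 ^ 2 := by
  simp [EuclideanSpace.norm_sq_eq]

theorem pd_bump (R : ℝ) (α : Fin 2) :
    pd α (bump R) = fun x : Plane => 2 * x α * deriv (bumpProfile R) (‖x‖ ^ 2) := by
  funext x
  exact pd_comp_norm_sq (differentiable_bumpProfile R _) α

theorem pd_pd_bump (R : ℝ) (α β : Fin 2) (x : Plane) :
    pd β (pd α (bump R)) x = 2 * (if α = β then 1 else 0) * deriv (bumpProfile R) (‖x‖ ^ 2) +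
      4 * x α * x β * deriv (deriv (bumpProfile R)) (‖x‖ ^ 2) := by
  have h : DifferentiableAt ℝ (deriv (bumpProfile R)) (‖x‖ ^ 2) :=
    (contDiff_deriv_bumpProfile R).differentiable (by simp) _
  have h' : DifferentiableAt ℝ (fun y : Plane => deriv (bumpProfile R) (‖y‖ ^ 2)) x :=
    (h.comp x (hasFDerivAt_norm_sq x).differentiableAt :
      DifferentiableAt ℝ (deriv (bumpProfile R) ∘ fun y : Plane => ‖y‖ ^ 2) x)
  rw [pd_bump, pd_mul_apply ((differentiableAt_coord α x).const_mul 2) h', pd_comp_norm_sq h,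
    pd_const_mul_apply (differentiableAt_coord α x), pd_coord]
  ring

/-- The integral of `h'(r²)`, where `h` is the profile of the cut-off. -/
noncomputable def bumpMass (R : ℝ) : ℝ :=
  ∫ x : Plane, 2 * deriv (bumpProfile R) (‖x‖ ^ 2)

/-- The profile is nonincreasing and falls from 1 to 0, so the continuous integrand has one sign and
is somewhere nonzero. Polar coordinates would give the value -2π, but only nonvanishing is needed,
for the divisions below. -/
theorem bumpMass_ne_zero {R : ℝ} (hR : 0 < R) : bumpMass R ≠ 0 := by
  obtain ⟨t, ht, hslope⟩ := exists_deriv_eq_slope (bumpProfile R) (a := 0) (b := R ^ 2)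
    (by positivity) (differentiable_bumpProfile R).continuous.continuousOn
    (differentiable_bumpProfile R).differentiableOn
  have h0 : bumpProfile R 0 = 1 := Real.smoothTransition.one_of_one_le (by simp)
  have h1 : bumpProfile R (R ^ 2) = 0 := Real.smoothTransition.zero_of_nonpos (by
    rw [← mul_pow, inv_mul_cancel₀ hR.ne']; norm_num)
  have hne : deriv (bumpProfile R) t ≠ 0 := by
    rw [hslope, h0, h1]
    have : R ^ 2 ≠ 0 := by positivity
    simp [this]
  have hcont : Continuous fun x : Plane => -(2 * deriv (bumpProfile R) (‖x‖ ^ 2)) :=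
    (continuous_const.mul ((contDiff_deriv_bumpProfile R).continuous.comp
      (by fun_prop))).neg
  have hpos := hcont.integral_pos_of_hasCompactSupport_nonneg_nonzero (μ := volume)
    -- A point at squared distance `t`, where the mean value theorem gives a nonzero derivative.
    (x := EuclideanSpace.single 0 (√t)) ?_ (fun x => ?_) ?_
  · rw [integral_neg] at hpos
    exact fun h => by unfold bumpMass at h; linarith
  · refine HasCompactSupport.intro (isCompact_closedBall 0 R) fun x hx => ?_
    rw [mem_closedBall_zero_iff, not_le] at hx
    have hev : bumpProfile R =ᶠ[𝓝 (‖x‖ ^ 2)] fun _ => 0 := by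
      have : R ^ 2 < ‖x‖ ^ 2 := by gcongr
      filter_upwards [lt_mem_nhds this] with s hs
      refine le_antisymm ?_ (Real.smoothTransition.nonneg _)
      exact (antitone_bumpProfile R hs.le).trans_eq h1
    simp [hev.deriv_eq]
  · have := deriv_bumpProfile_nonpos R (‖x‖ ^ 2)
    simp only [Pi.zero_apply]
    linarith
  · simpa [Real.sq_sqrt ht.1.le] using hne

/-! ### The singular fields -/

/-- The field `x_α / r²`. -/
noncomputable def radialField (α : Fin 2) (x : Plane) : ℝ := x α / ‖x‖ ^ 2

/-- The tensor field `x_α x_β / r²`. -/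
noncomputable def radialTensor (α β : Fin 2) (x : Plane) : ℝ := x α * x β / ‖x‖ ^ 2

theorem contDiffOn_div_norm_sq {f : Plane → ℝ} (hf : ContDiff ℝ ∞ f) :
    ContDiffOn ℝ ∞ (fun x => f x / ‖x‖ ^ 2) {0}ᶜ :=
  hf.contDiffOn.div (contDiff_norm_sq ℝ).contDiffOn fun x hx => by simpa using hx

theorem contDiffOn_radialField (α : Fin 2) : ContDiffOn ℝ ∞ (radialField α) {0}ᶜ :=
  contDiffOn_div_norm_sq (contDiff_coord α)

theorem contDiffOn_radialTensor (α β : Fin 2) : ContDiffOn ℝ ∞ (radialTensor α β) {0}ᶜ :=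
  contDiffOn_div_norm_sq ((contDiff_coord α).mul (contDiff_coord β))

theorem pd_radialField (α β : Fin 2) {x : Plane} (hx : x ≠ 0) :
    pd β (radialField α) x =
      ((if α = β then 1 else 0) * ‖x‖ ^ 2 - x α * (2 * x β)) / (‖x‖ ^ 2) ^ 2 := by
  rw [← pd_coord β α x]
  exact pd_div_norm_sq (differentiableAt_coord α x) hx β

/-- The field is the gradient of log r, which is harmonic off the origin. -/
theorem div_radialField {x : Plane} (hx : x ≠ 0) : ∑ α, pd α (radialField α) x = 0 := by
  simp only [pd_radialField _ _ hx, Fin.sum_univ_two, norm_sq_plane]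
  simp only [← add_div]
  simp
  left
  ring

theorem pd_radialField_comm (α β : Fin 2) {x : Plane} (hx : x ≠ 0) :
    pd β (radialField α) x = pd α (radialField β) x := by
  rw [pd_radialField _ _ hx, pd_radialField _ _ hx]
  simp only [eq_comm (a := α)]
  ring

theorem pd_radialTensor (α β γ : Fin 2) {x : Plane} (hx : x ≠ 0) :
    pd γ (radialTensor α β) x =
      (((if α = γ then 1 else 0) * x β + x α * (if β = γ then 1 else 0)) * ‖x‖ ^ 2
        - x α * x β * (2 * x γ)) / (‖x‖ ^ 2) ^ 2 := by
  rw [← pd_coord γ α x, ← pd_coord γ β x,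
    ← pd_mul_apply (differentiableAt_coord α x) (differentiableAt_coord β x)]
  exact pd_div_norm_sq ((differentiableAt_coord α x).mul (differentiableAt_coord β x)) hx γ

theorem abs_radialField_le (α : Fin 2) (x : Plane) : |radialField α x| ≤ ‖x‖⁻¹ := by
  unfold radialField
  rcases eq_or_ne x 0 with rfl | hx
  · simp
  have h := PiLp.norm_apply_le x α
  have hx' : 0 < ‖x‖ := by simpa using hx
  rw [abs_div, abs_of_nonneg (sq_nonneg ‖x‖), div_le_iff₀ (by positivity)]
  rw [Real.norm_eq_abs] at h
  calc |x α| ≤ ‖x‖ := h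
    _ = ‖x‖⁻¹ * ‖x‖ ^ 2 := by field_simp

theorem abs_radialTensor_le (α β : Fin 2) (x : Plane) : |radialTensor α β x| ≤ 1 := by
  unfold radialTensor
  have h1 := PiLp.norm_apply_le x α
  have h2 := PiLp.norm_apply_le x β
  rw [Real.norm_eq_abs] at h1 h2
  rw [abs_div, abs_of_nonneg (sq_nonneg ‖x‖), abs_mul, pow_two]
  exact div_le_one_of_le₀ (by gcongr) (by positivity)

theorem measurable_radialField (α : Fin 2) : Measurable (radialField α) := by
  unfold radialField
  fun_prop

theorem measurable_radialTensor (α β : Fin 2) : Measurable (radialTensor α β) := by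
  unfold radialTensor
  fun_prop

/-- In polar coordinates the Jacobian t cancels t⁻¹. -/
theorem locallyIntegrable_inv_norm : LocallyIntegrable (fun x : Plane => ‖x‖⁻¹) := by
  rw [locallyIntegrable_iff]
  intro K hK
  obtain ⟨r, hr⟩ := hK.isBounded.subset_ball 0
  refine IntegrableOn.mono_set ?_ hr
  rw [integrableOn_fun_norm_addHaar volume (f := fun t : ℝ => t⁻¹)]
  refine (integrableOn_const (C := (1 : ℝ)) (by simp)).congr_fun (fun t ht => ?_) measurableSet_Ioo
  have := ht.1.ne'
  simp [this]

theorem locallyIntegrable_radialField (α : Fin 2) : LocallyIntegrable (radialField α) :=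
  locallyIntegrable_inv_norm.mono (measurable_radialField α).aestronglyMeasurable
    (.of_forall fun x => by simpa using abs_radialField_le α x)

theorem locallyIntegrable_radialTensor (α β : Fin 2) : LocallyIntegrable (radialTensor α β) :=
  (locallyIntegrable_const (1 : ℝ)).mono (measurable_radialTensor α β).aestronglyMeasurable
    (.of_forall fun x => by simpa using abs_radialTensor_le α β x)

theorem isLittleO_inv_norm :
    (fun x : Plane => ‖x‖⁻¹) =o[𝓝[≠] 0] fun x => (‖x‖ ^ 2)⁻¹ := by
  have h : Tendsto (fun x : Plane => ‖x‖) (𝓝[≠] 0) (𝓝 0) := by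
    simpa using (continuous_norm (E := Plane)).continuousAt (x := 0) |>.mono_left nhdsWithin_le_nhds
  refine isLittleO_of_tendsto' ?_ (h.congr' ?_)
  · filter_upwards [self_mem_nhdsWithin] with x hx h0
    simp at h0
    exact absurd h0 hx
  · filter_upwards [self_mem_nhdsWithin] with x hx
    have : ‖x‖ ≠ 0 := by simpa using hx
    field_simp

theorem isLittleO_of_continuousAt {f : Plane → ℝ} (hf : ContinuousAt f 0) :
    f =o[𝓝[≠] 0] fun x => (‖x‖ ^ 2)⁻¹ := by
  refine (hf.mono_left nhdsWithin_le_nhds).isBigO_one ℝ |>.trans_isLittleO ?_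
  rw [isLittleO_one_left_iff]
  have h : Tendsto (fun x : Plane => ‖x‖ ^ 2) (𝓝[≠] 0) (𝓝[>] 0) := by
    refine tendsto_nhdsWithin_iff.2 ⟨?_, ?_⟩
    · have : Continuous fun x : Plane => ‖x‖ ^ 2 := by fun_prop
      simpa using this.continuousAt (x := 0) |>.mono_left nhdsWithin_le_nhds
    · filter_upwards [self_mem_nhdsWithin] with x hx
      have : x ≠ 0 := hx
      simp only [Set.mem_Ioi]
      positivity
  have h' : Tendsto (fun x : Plane => (‖x‖ ^ 2)⁻¹) (𝓝[≠] 0) atTop := h.inv_tendsto_nhdsGT_zero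
  simpa using h'

theorem isLittleO_radialField (α : Fin 2) :
    radialField α =o[𝓝[≠] 0] fun x => (‖x‖ ^ 2)⁻¹ :=
  (IsBigO.of_bound 1 (.of_forall fun x => by
    simpa using abs_radialField_le α x)).trans_isLittleO isLittleO_inv_norm

theorem isLittleO_radialTensor (α β : Fin 2) :
    radialTensor α β =o[𝓝[≠] 0] fun x => (‖x‖ ^ 2)⁻¹ :=
  (IsBigO.of_bound (g := fun _ => (1 : ℝ)) 1 (.of_forall fun x => by
    simpa using abs_radialTensor_le α β x)).trans_isLittleO
      (isLittleO_of_continuousAt continuousAt_const)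

/-! ### Rotated fields -/

/-- The rotated field `ε_{αβ} E_β`. -/
noncomputable def rot (E : Fin 2 → Plane → ℝ) (α : Fin 2) (x : Plane) : ℝ :=
  ∑ β, eps α β * E β x

/-- The rotated tensor field `ε_{αγ} ε_{βδ} E_{γδ}`. -/
noncomputable def rot2 (E : Fin 2 → Fin 2 → Plane → ℝ) (α β : Fin 2) (x : Plane) : ℝ :=
  ∑ γ, ∑ δ, eps α γ * eps β δ * E γ δ x

section Rot

variable (E : Fin 2 → Plane → ℝ) (F : Fin 2 → Fin 2 → Plane → ℝ)

theorem rot_zero : rot E 0 = E 1 := by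
  funext x
  simp [rot, eps]

theorem rot_one : rot E 1 = fun x => -E 0 x := by
  funext x
  simp [rot, eps]

theorem rot2_zero_zero : rot2 F 0 0 = F 1 1 := by
  funext x
  simp [rot2, eps]

theorem rot2_zero_one : rot2 F 0 1 = fun x => -F 1 0 x := by
  funext x
  simp [rot2, eps]

theorem rot2_one_zero : rot2 F 1 0 = fun x => -F 0 1 x := by
  funext x
  simp [rot2, eps]

theorem rot2_one_one : rot2 F 1 1 = F 0 0 := by
  funext x
  simp [rot2, eps]

/-- This turns the curl into a divergence, so that the flux lemmas apply. -/
theorem div_rot (x : Plane) :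
    ∑ α, pd α (rot E α) x = ∑ α, ∑ β, eps α β * pd α (E β) x := by
  simp [rot_zero, rot_one, eps, pd_neg]

theorem div_div_rot2 (x : Plane) :
    ∑ α, ∑ β, pd α (pd β (rot2 F α β)) x =
      ∑ α, ∑ β, ∑ γ, ∑ δ, eps α γ * eps β δ * pd α (pd β (F γ δ)) x := by
  have h : ∀ (i : Fin 2) (f : Plane → ℝ), pd i (fun y => -f y) = fun y => -pd i f y :=
    fun i f => funext fun y => pd_neg f i y
  simp [rot2_zero_zero, rot2_zero_one, rot2_one_zero, rot2_one_one, eps, h]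

variable {E F} {W : Set Plane}

theorem contDiffOn_rot (hE : ∀ α, ContDiffOn ℝ ∞ (E α) W) (α : Fin 2) :
    ContDiffOn ℝ ∞ (rot E α) W :=
  ContDiffOn.sum fun β _ => contDiffOn_const.mul (hE β)

theorem contDiffOn_rot2 (hF : ∀ α β, ContDiffOn ℝ ∞ (F α β) W) (α β : Fin 2) :
    ContDiffOn ℝ ∞ (rot2 F α β) W :=
  ContDiffOn.sum fun γ _ => ContDiffOn.sum fun δ _ => contDiffOn_const.mul (hF γ δ)

theorem MeasureTheory.LocallyIntegrableOn.const_mul' {f : Plane → ℝ}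
    (hf : LocallyIntegrableOn f W) (c : ℝ) : LocallyIntegrableOn (fun x => c * f x) W :=
  hf.smul c

theorem locallyIntegrableOn_rot (hE : ∀ α, LocallyIntegrableOn (E α) W) (α : Fin 2) :
    LocallyIntegrableOn (rot E α) W :=
  locallyIntegrableOn_finsetSum _ fun β _ => (hE β).const_mul' _

theorem locallyIntegrableOn_rot2 (hF : ∀ α β, LocallyIntegrableOn (F α β) W) (α β : Fin 2) :
    LocallyIntegrableOn (rot2 F α β) W :=
  locallyIntegrableOn_finsetSum _ fun γ _ => locallyIntegrableOn_finsetSum _ fun δ _ =>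
    (hF γ δ).const_mul' _

end Rot

/-! ### The fluxes of the singular fields -/

section Singular

variable {U : Set Plane} {φ : Plane → ℝ} {R : ℝ}

theorem diff_subset_compl_zero (U : Set Plane) : U \ {0} ⊆ {0}ᶜ := fun _ hx => hx.2

theorem flux_radialField_bump (R : ℝ) : flux radialField (bump R) = bumpMass R := by
  refine integral_congr_ae ?_
  filter_upwards [Measure.ae_ne volume (0 : Plane)] with x hx
  have hx' : ‖x‖ ^ 2 ≠ 0 := by simpa using hx
  simp only [pd_bump, radialField, Fin.sum_univ_two]
  field_simp
  rw [norm_sq_plane]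
  ring

/-- The divergence of x/r² is a multiple of the Dirac mass; testing with the radial cut-off
identifies the multiple. -/
theorem flux_radialField (hU : IsOpen U) (hR : 0 < R) (hRU : Metric.closedBall 0 R ⊆ U)
    (hφ : IsTest U φ) : flux radialField φ = φ 0 * bumpMass R := by
  rw [← flux_radialField_bump]
  exact flux_eq_mul hU (fun α => (locallyIntegrable_radialField α).locallyIntegrableOn U)
    (fun α => (contDiffOn_radialField α).mono (diff_subset_compl_zero U))
    (fun x hx => div_radialField hx.2) (isTest_bump hR hRU) (bump_eventuallyEq_one R) hφ

/-- The gradient of log r is curl-free across the origin too: its rotation is orthogonal to the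
gradient of a radial cut-off, so the Dirac coefficient is 0. -/
theorem flux_rot_radialField (hU : IsOpen U) (hR : 0 < R) (hRU : Metric.closedBall 0 R ⊆ U)
    (hφ : IsTest U φ) : flux (rot radialField) φ = 0 := by
  have h := flux_eq_mul hU (A := rot radialField)
    (locallyIntegrableOn_rot fun α => (locallyIntegrable_radialField α).locallyIntegrableOn U)
    (contDiffOn_rot fun α => (contDiffOn_radialField α).mono (diff_subset_compl_zero U))
    (fun x hx => ?_) (isTest_bump hR hRU) (bump_eventuallyEq_one R) hφ
  · have h0 : flux (rot radialField) (bump R) = 0 := by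
      refine integral_eq_zero_of_ae (.of_forall fun x => ?_)
      simp only [pd_bump, Fin.sum_univ_two, rot_zero, rot_one, radialField, Pi.zero_apply]
      ring
    rw [h, h0, mul_zero]
  · rw [Fin.sum_univ_two, rot_zero, rot_one, pd_neg, pd_radialField_comm _ _ hx.2, add_neg_cancel]

/-- The isotropic tensor field `δ_{αβ} x_γ / r²`. -/
noncomputable def isotropicTensor (γ α β : Fin 2) (x : Plane) : ℝ :=
  if α = β then radialField γ x else 0

/-- Rotation preserves isotropic tensors, so the pairing is ∫ (x_γ/r²) Δφ. It differs from the flux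
of x/r² against ∂_γ φ by a flux of the rotated field against the other partial derivative, which is
zero. -/
theorem flux2_rot2_isotropicTensor (hU : IsOpen U) (hR : 0 < R)
    (hRU : Metric.closedBall 0 R ⊆ U) (hφ : IsTest U φ) (γ : Fin 2) :
    flux2 (rot2 (isotropicTensor γ)) φ = pd γ φ 0 * bumpMass R := by
  have hG : ∀ α, LocallyIntegrableOn (radialField α) U := fun α =>
    (locallyIntegrable_radialField α).locallyIntegrableOn U
  have h1 := flux_radialField hU hR hRU (hφ.pd γ)
  have h2 := flux_rot_radialField hU hR hRU (hφ.pd 0)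
  have h3 := flux_rot_radialField hU hR hRU (hφ.pd 1)
  have hcomm := pd_comm hφ.1 1 0
  rw [← h1]
  fin_cases γ
  · rw [← sub_zero (flux radialField _), ← h3]
    unfold flux2 flux
    refine Eq.trans ?_ (integral_sub (integrable_flux hG (hφ.pd 0))
      (integrable_flux (locallyIntegrableOn_rot hG) (hφ.pd 1)))
    congr 1
    funext x
    simp [rot2_zero_zero, rot2_zero_one, rot2_one_zero, rot2_one_one, rot_zero, rot_one,
      isotropicTensor, hcomm]
    ring
  · rw [← add_zero (flux radialField _), ← h2]
    unfold flux2 flux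
    refine Eq.trans ?_ (integral_add (integrable_flux hG (hφ.pd 1))
      (integrable_flux (locallyIntegrableOn_rot hG) (hφ.pd 0)))
    congr 1
    funext x
    simp [rot2_zero_zero, rot2_zero_one, rot2_one_zero, rot2_one_one, rot_zero, rot_one,
      isotropicTensor, hcomm]
    ring

/-- With h the profile, the Hessian of the cut-off is 2h'(r²)δ_{αβ} + 4h''(r²)x_α x_β. The rotated
tensor has trace 1 and annihilates x, so only 2h'(r²) survives. -/
theorem flux2_rot2_radialTensor_bump (R : ℝ) :
    flux2 (rot2 radialTensor) (bump R) = bumpMass R := by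
  refine integral_congr_ae ?_
  filter_upwards [Measure.ae_ne volume (0 : Plane)] with x hx
  have hx' : ‖x‖ ^ 2 ≠ 0 := by simpa using hx
  simp only [pd_pd_bump, radialTensor, Fin.sum_univ_two, rot2_zero_zero, rot2_zero_one,
    rot2_one_zero, rot2_one_one]
  field_simp
  simp
  rw [norm_sq_plane]
  ring

/-- The rotated tensor is y ⊗ y/r² with y the vector x turned by a right angle. As div y = 0 and y ·
∇r² = 0, its divergence is (y · ∇)y/r² = -x/r². -/
theorem div_rot2_radialTensor (α : Fin 2) {x : Plane} (hx : x ≠ 0) :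
    ∑ β, pd β (rot2 radialTensor α β) x = -radialField α x := by
  have hx' : x 0 ^ 2 + x 1 ^ 2 ≠ 0 := by
    rw [← norm_sq_plane]
    simpa using hx
  fin_cases α <;>
  · simp [rot2_zero_zero, rot2_zero_one, rot2_one_zero, rot2_one_one, pd_neg,
      pd_radialTensor _ _ _ hx, radialField, norm_sq_plane]
    field_simp
    ring

theorem div_div_rot2_radialTensor {x : Plane} (hx : x ≠ 0) :
    ∑ α, ∑ β, pd α (pd β (rot2 radialTensor α β)) x = 0 := by
  have hopen : IsOpen ({0}ᶜ : Set Plane) := isOpen_compl_singleton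
  have hd : ∀ α β, DifferentiableAt ℝ (pd β (rot2 radialTensor α β)) x := fun α β =>
    ((contDiffOn_rot2 contDiffOn_radialTensor α β).pd hopen β).differentiableAt_of_isOpen hopen hx
  have h : ∀ α, ∑ β, pd α (pd β (rot2 radialTensor α β)) x = -pd α (radialField α) x := by
    intro α
    have hev : (fun y => ∑ β, pd β (rot2 radialTensor α β) y) =ᶠ[𝓝 x] fun y => -radialField α y := by
      filter_upwards [hopen.mem_nhds hx] with y hy
      exact div_rot2_radialTensor α hy
    rw [← pd_neg, ← (pd_congr hev α).eq_of_nhds]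
    simp only [Fin.sum_univ_two]
    rw [pd_add_apply (hd α 0) (hd α 1)]
  simp only [h, Finset.sum_neg_distrib, div_radialField hx, neg_zero]

end Singular

/-! ### Removing the concentrated incompatibility -/

section Correction

variable {U : Set Plane}

/-- The field of a rigid rotation. -/
noncomputable def rotationField : Fin 2 → Plane → ℝ := ![fun x => -x 1, fun x => x 0]

theorem contDiff_rotationField (α : Fin 2) : ContDiff ℝ ∞ (rotationField α) := by
  fin_cases α
  · exact (contDiff_coord 1).neg
  · exact contDiff_coord 0

theorem curl_rotationField (x : Plane) :
    ∑ α, ∑ β, eps α β * pd α (rotationField β) x = 2 := by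
  simp [eps, rotationField, pd_neg, pd_coord]
  norm_num

/-- A planar field with constant curl off the origin is the sum of a field that is curl-free in the
sense of distributions and of a field that is `o(r⁻²)`. -/
theorem exists_curl_correction (hU : IsOpen U) {w : Fin 2 → Plane → ℝ}
    (hw : ∀ α, ContDiffOn ℝ ∞ (w α) (U \ {0})) (hw' : ∀ α, LocallyIntegrableOn (w α) U) {K : ℝ}
    (hK : ∀ x ∈ U \ {0}, ∑ α, ∑ β, eps α β * pd α (w β) x = K) :
    ∃ e : Fin 2 → Plane → ℝ, (∀ κ, LocallyIntegrable (e κ)) ∧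
      (∀ κ, e κ =o[𝓝[≠] 0] fun y => (‖y‖ ^ 2)⁻¹) ∧
      ∀ φ, IsTest U φ → flux (rot fun β x => w β x - e β x) φ = 0 := by
  have hU' : IsOpen (U \ {0}) := hU.sdiff isClosed_singleton
  have hk : ∀ β, LocallyIntegrable fun x => K / 2 * rotationField β x := fun β =>
    (continuous_const.mul (contDiff_rotationField β).continuous).locallyIntegrable
  have hko : ∀ β, (fun x => K / 2 * rotationField β x) =o[𝓝[≠] 0] fun y => (‖y‖ ^ 2)⁻¹ :=
    fun β => isLittleO_of_continuousAt
      (continuous_const.mul (contDiff_rotationField β).continuous).continuousAt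
  -- The rigid rotation has curl 2, so this multiple removes the constant `K`.
  let v : Fin 2 → Plane → ℝ := fun β x => w β x - K / 2 * rotationField β x
  have hv : ∀ α, ContDiffOn ℝ ∞ (rot v α) (U \ {0}) := contDiffOn_rot fun α =>
    (hw α).sub (contDiff_const.mul (contDiff_rotationField α)).contDiffOn
  have hv' : ∀ α, LocallyIntegrableOn (rot v α) U := locallyIntegrableOn_rot fun α =>
    (hw' α).sub ((hk α).locallyIntegrableOn U)
  have hdiv : ∀ x ∈ U \ {0}, ∑ α, pd α (rot v α) x = 0 := by
    intro x hx
    have hd : ∀ α β, pd α (v β) x = pd α (w β) x - K / 2 * pd α (rotationField β) x := by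
      intro α β
      have h := (contDiff_rotationField β).differentiable (by simp) x
      rw [← pd_const_mul_apply h]
      exact pd_sub_apply ((hw β).differentiableAt_of_isOpen hU' hx) (h.const_mul _) α
    rw [div_rot]
    simp only [hd, mul_sub, Finset.sum_sub_distrib, hK x hx]
    simp only [mul_left_comm (eps _ _), ← Finset.mul_sum, curl_rotationField]
    ring
  by_cases h0 : (0 : Plane) ∈ U
  · obtain ⟨R, hR, hRU⟩ := Metric.nhds_basis_closedBall.mem_iff.1 (hU.mem_nhds h0)
    have hm := bumpMass_ne_zero hR
    -- The Dirac coefficient of the remaining curl, in units of that of x/r². Rotating twice is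
    -- multiplication by -1, whence the minus sign before `a` in the correction.
    let a : ℝ := flux (rot v) (bump R) / bumpMass R
    have hrG : ∀ β, LocallyIntegrable (rot radialField β) := fun β =>
      locallyIntegrableOn_univ.1 (locallyIntegrableOn_rot (fun α =>
        (locallyIntegrable_radialField α).locallyIntegrableOn _) β)
    have hrGo : ∀ β, rot radialField β =o[𝓝[≠] 0] fun y => (‖y‖ ^ 2)⁻¹ := by
      intro β
      unfold rot
      simp only [Fin.sum_univ_two]
      exact ((isLittleO_radialField 0).const_mul_left _).add
        ((isLittleO_radialField 1).const_mul_left _)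
    refine ⟨fun β x => K / 2 * rotationField β x - a * rot radialField β x,
      fun β => (hk β).sub ((hrG β).smul a), fun β => (hko β).sub ((hrGo β).const_mul_left a),
      fun φ hφ => ?_⟩
    have hrot : (rot fun β x => w β x - (K / 2 * rotationField β x - a * rot radialField β x)) =
        fun α x => rot v α x - a * radialField α x := by
      funext α x
      fin_cases α <;> simp [rot_zero, rot_one, v] <;> ring
    rw [hrot, flux_sub_const_mul hv' (fun α =>
      (locallyIntegrable_radialField α).locallyIntegrableOn U) a hφ,
      flux_eq_mul hU hv' hv hdiv (isTest_bump hR hRU) (bump_eventuallyEq_one R) hφ,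
      flux_radialField hU hR hRU hφ]
    simp only [a]
    field_simp
    ring
  · refine ⟨fun β x => K / 2 * rotationField β x, hk, hko, fun φ hφ => ?_⟩
    exact flux_eq_zero hU' hv hdiv (hφ.of_notMem_tsupport fun h => h0 (hφ.3 h))

/-- A planar tensor field that is compatible off the origin is the sum of a field that is compatible
in the sense of distributions and of a field that is `o(r⁻²)`. -/
theorem exists_incompat_correction (hU : IsOpen U) {s : Fin 2 → Fin 2 → Plane → ℝ}
    (hs : ∀ α β, ContDiffOn ℝ ∞ (s α β) (U \ {0})) (hs' : ∀ α β, LocallyIntegrableOn (s α β) U)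
    (hinc : ∀ x ∈ U \ {0},
      ∑ α, ∑ β, ∑ γ, ∑ δ, eps α γ * eps β δ * pd α (pd β (s γ δ)) x = 0) :
    ∃ e : Fin 2 → Fin 2 → Plane → ℝ, (∀ α β, e α β = e β α) ∧
      (∀ α β, LocallyIntegrable (e α β)) ∧
      (∀ α β, e α β =o[𝓝[≠] 0] fun y => (‖y‖ ^ 2)⁻¹) ∧
      ∀ φ, IsTest U φ → flux2 (rot2 fun α β x => s α β x - e α β x) φ = 0 := by
  have hU' : IsOpen (U \ {0}) := hU.sdiff isClosed_singleton
  have hA := contDiffOn_rot2 hs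
  have hA' := locallyIntegrableOn_rot2 hs'
  have hdiv : ∀ x ∈ U \ {0}, ∑ α, ∑ β, pd α (pd β (rot2 s α β)) x = 0 := fun x hx => by
    rw [div_div_rot2]
    exact hinc x hx
  by_cases h0 : (0 : Plane) ∈ U
  · obtain ⟨R, hR, hRU⟩ := Metric.nhds_basis_closedBall.mem_iff.1 (hU.mem_nhds h0)
    have hm := bumpMass_ne_zero hR
    have hη : IsTest U (bump R) := isTest_bump hR hRU
    have hη1 := bump_eventuallyEq_one (V := Plane) R
    let p : (Fin 2 → Fin 2 → Plane → ℝ) → Fin 2 → ℝ := fun F γ =>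
      flux2 (rot2 F) fun x => x γ * bump R x
    -- The system for the coefficients is triangular: isotropic tensors contribute no Dirac mass, so
    -- `a` is fixed by the zeroth moment alone. Then `b` matches the first moments after deducting
    -- those of `a * radialTensor`, which need not be computed.
    let a : ℝ := flux2 (rot2 s) (bump R) / bumpMass R
    let b : Fin 2 → ℝ := fun γ => (p s γ - a * p radialTensor γ) / bumpMass R
    have hI : ∀ γ α β, LocallyIntegrable (isotropicTensor γ α β) := by
      intro γ α β
      unfold isotropicTensor
      split_ifs
      · exact locallyIntegrable_radialField γ
      · exact locallyIntegrable_const _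
    have hIo : ∀ γ α β, isotropicTensor γ α β =o[𝓝[≠] 0] fun y => (‖y‖ ^ 2)⁻¹ := by
      intro γ α β
      unfold isotropicTensor
      split_ifs
      · exact isLittleO_radialField γ
      · exact isLittleO_zero _ _
    refine ⟨fun α β x => a * radialTensor α β x + b 0 * isotropicTensor 0 α β x +
      b 1 * isotropicTensor 1 α β x, fun α β => ?_, fun α β => ?_, fun α β => ?_, fun φ hφ => ?_⟩
    · funext x
      simp only [radialTensor, isotropicTensor, eq_comm (a := α), mul_comm (x α)]
    · exact (((locallyIntegrable_radialTensor α β).smul a).add ((hI 0 α β).smul (b 0))).add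
        ((hI 1 α β).smul (b 1))
    · exact (((isLittleO_radialTensor α β).const_mul_left a).add
        ((hIo 0 α β).const_mul_left (b 0))).add ((hIo 1 α β).const_mul_left (b 1))
    · have hrot : (rot2 fun α β x => s α β x - (a * radialTensor α β x +
            b 0 * isotropicTensor 0 α β x + b 1 * isotropicTensor 1 α β x)) =
          fun α β x => ((rot2 s α β x - a * rot2 radialTensor α β x) -
            b 0 * rot2 (isotropicTensor 0) α β x) - b 1 * rot2 (isotropicTensor 1) α β x := by
        funext α β x
        fin_cases α <;> fin_cases β <;>
          simp [rot2_zero_zero, rot2_zero_one, rot2_one_zero, rot2_one_one] <;> ring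
      have hN := locallyIntegrableOn_rot2 fun α β =>
        (locallyIntegrable_radialTensor α β).locallyIntegrableOn U
      have hJ := fun γ => locallyIntegrableOn_rot2 fun α β => (hI γ α β).locallyIntegrableOn U
      have hAN : ∀ α β, LocallyIntegrableOn
          (fun x => rot2 s α β x - a * rot2 radialTensor α β x) U :=
        fun α β => (hA' α β).sub ((hN α β).const_mul' a)
      have hANJ : ∀ α β, LocallyIntegrableOn (fun x => rot2 s α β x -
          a * rot2 radialTensor α β x - b 0 * rot2 (isotropicTensor 0) α β x) U :=
        fun α β => (hAN α β).sub ((hJ 0 α β).const_mul' (b 0))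
      have hjet_s := flux2_eq_jet hU hA' hA hdiv hη hη1 hφ
      have hjet_N := flux2_eq_jet hU hN
        (contDiffOn_rot2 fun α β => (contDiffOn_radialTensor α β).mono (diff_subset_compl_zero U))
        (fun x hx => div_div_rot2_radialTensor hx.2) hη hη1 hφ
      rw [flux2_rot2_radialTensor_bump] at hjet_N
      rw [hrot, flux2_sub_const_mul hANJ (hJ 1) (b 1) hφ, flux2_sub_const_mul hAN (hJ 0) (b 0) hφ,
        flux2_sub_const_mul hA' hN a hφ, flux2_rot2_isotropicTensor hU hR hRU hφ,
        flux2_rot2_isotropicTensor hU hR hRU hφ, hjet_s, hjet_N]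
      simp only [Fin.sum_univ_two]
      have ha : a * bumpMass R = flux2 (rot2 s) (bump R) := div_mul_cancel₀ _ hm
      have hb : ∀ γ, b γ * bumpMass R = p s γ - a * p radialTensor γ := fun γ =>
        div_mul_cancel₀ _ hm
      linear_combination -φ 0 * ha - pd 0 φ 0 * hb 0 - pd 1 φ 0 * hb 1
  · refine ⟨fun _ _ _ => 0, fun _ _ => rfl, fun _ _ => locallyIntegrable_const _,
      fun _ _ => isLittleO_zero _ _, fun φ hφ => ?_⟩
    simp only [sub_zero]
    exact flux2_eq_zero hU' hA hdiv (hφ.of_notMem_tsupport fun h => h0 (hφ.3 h))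

end Correction

/-! ### Distributions defined by planar fields -/

section Distributions

variable {n : ℕ} {U : Opens (EuclideanSpace ℝ (Fin n))} {f : EuclideanSpace ℝ (Fin n) → ℝ}

theorem TestFunction.isTest (φ : 𝓓(U, ℝ)) : IsTest (U : Set (EuclideanSpace ℝ (Fin n))) φ :=
  ⟨φ.contDiff, φ.hasCompactSupport, φ.tsupport_subset⟩

theorem TestFunction.coe_lineDeriv_base (φ : 𝓓(U, ℝ)) (i : Fin n) :
    ((∂_{base i} φ : 𝓓(U, ℝ)) : EuclideanSpace ℝ (Fin n) → ℝ) = pd i φ := by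
  funext x
  rw [TestFunction.lineDerivOp_eq_lineDerivCLM ℝ, TestFunction.lineDerivCLM_apply_of_le (by simp),
    (φ.contDiff.differentiable (by simp)).differentiableAt.lineDeriv_eq_fderiv]
  rfl

theorem lineDeriv_toDist_apply (hf : LocallyIntegrableOn f U) (i : Fin n) (φ : 𝓓(U, ℝ)) :
    (∂_{base i} (toDist U f)) φ = -∫ x, f x * pd i φ x := by
  rw [Distribution.lineDerivOp_apply_apply, map_neg, toDist_apply hf]
  simp only [TestFunction.coe_lineDeriv_base, mul_comm (f _)]

theorem lineDeriv_lineDeriv_toDist_apply (hf : LocallyIntegrableOn f U) (i j : Fin n)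
    (φ : 𝓓(U, ℝ)) :
    (∂_{base i} (∂_{base j} (toDist U f))) φ = ∫ x, f x * pd j (pd i φ) x := by
  rw [Distribution.lineDerivOp_apply_apply, map_neg, lineDeriv_toDist_apply hf, neg_neg]
  simp only [TestFunction.coe_lineDeriv_base]

end Distributions

/-! ### From vanishing fluxes to vanishing distributions -/

section CurlIncompat

variable {U : Opens Plane}

theorem curl_eq_zero {E : Fin 2 → Plane → ℝ} (hE : ∀ κ, LocallyIntegrableOn (E κ) U)
    (h : ∀ φ, IsTest (U : Set Plane) φ → flux (rot E) φ = 0) : curl U E = 0 := by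
  ext φ
  have hφ := φ.isTest
  have h0 := h φ hφ
  rw [flux_eq_sum (locallyIntegrableOn_rot hE) hφ] at h0
  have hc : curl U E φ = ∑ α, ∑ β, eps α β * (∂_{base α} (toDist U (E β))) φ := by
    simp only [curl, Fin.sum_univ_two]
    rfl
  rw [hc]
  simp only [lineDeriv_toDist_apply (hE _)]
  simp [rot_zero, rot_one, eps, integral_neg] at h0 ⊢
  linarith

theorem incompat_eq_zero {E : Fin 2 → Fin 2 → Plane → ℝ}
    (hE : ∀ α β, LocallyIntegrableOn (E α β) U)
    (h : ∀ φ, IsTest (U : Set Plane) φ → flux2 (rot2 E) φ = 0) : incompat U E = 0 := by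
  ext φ
  have hφ := φ.isTest
  have h0 := h φ hφ
  rw [flux2_eq_sum (locallyIntegrableOn_rot2 hE) hφ] at h0
  have hc : incompat U E φ = ∑ α, ∑ β, ∑ γ, ∑ δ, (eps α γ * eps β δ) *
      (∂_{base α} (∂_{base β} (toDist U (E γ δ)))) φ := by
    simp only [incompat, Fin.sum_univ_two]
    rfl
  rw [hc]
  simp only [lineDeriv_lineDeriv_toDist_apply (hE _ _)]
  simp [rot2_zero_zero, rot2_zero_one, rot2_one_zero, rot2_one_one, eps, integral_neg] at h0 ⊢
  linarith

end CurlIncompat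

/-! ### The planar field of a strain that does not depend on the height -/

section Geometry

theorem planar_lift (z : ℝ) (y : Plane) : planar (lift z y) = y := by
  ext i
  fin_cases i <;> simp [planar, lift]

theorem lift_planar (x : Space) : lift (x 2) (planar x) = x := by
  ext i
  fin_cases i <;> simp [planar, lift]

/-- The projection to the plane, as a continuous linear map. -/
noncomputable def planarCLM : Space →L[ℝ] Plane :=
  LinearMap.toContinuousLinearMap
    { toFun := planar
      map_add' := fun x y => by ext i; fin_cases i <;> simp [planar]
      map_smul' := fun c x => by ext i; fin_cases i <;> simp [planar] }

theorem coe_planarCLM : ⇑planarCLM = planar := rfl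

theorem planar_base (i : Fin 2) : planar (base (sp i)) = base i := by
  ext j
  fin_cases i <;> fin_cases j <;> simp [planar, sp]

theorem continuous_planar : Continuous planar := planarCLM.continuous

theorem contDiff_lift (z : ℝ) : ContDiff ℝ ∞ (lift z) := by
  rw [contDiff_piLp]
  intro i
  fin_cases i
  · exact contDiff_coord 0
  · exact contDiff_coord 1
  · exact contDiff_const

theorem pd_comp_planar {f : Plane → ℝ} {x : Space} (hf : DifferentiableAt ℝ f (planar x))
    (i : Fin 2) : pd (sp i) (fun y => f (planar y)) x = pd i f (planar x) := by
  have h : HasFDerivAt (fun y => f (planar y)) ((fderiv ℝ f (planar x)).comp planarCLM) x :=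
    hf.hasFDerivAt.comp x planarCLM.hasFDerivAt
  simp only [pd, h.fderiv, ContinuousLinearMap.comp_apply, coe_planarCLM, planar_base]

theorem isOpen_offLine (Ω : Opens Space) : IsOpen (offLine Ω) :=
  Ω.isOpen.inter (isOpen_compl_singleton.preimage continuous_planar)

/-- Splitting off the third coordinate preserves volume; this supplies the change of variables for
Fubini. -/
theorem measurePreserving_lift :
    MeasurePreserving (fun p : ℝ × Plane => lift p.1 p.2) (volume.prod volume) volume := by
  have h1 : MeasurePreserving (Prod.map id (WithLp.ofLp : Plane → Fin 2 → ℝ))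
      (volume.prod volume) ((volume : Measure ℝ).prod volume) :=
    (MeasurePreserving.id volume).prod (PiLp.volume_preserving_ofLp (Fin 2))
  have h2 := (volume_preserving_piFinSuccAbove (fun _ : Fin 3 => ℝ) 2).symm
  have h3 := PiLp.volume_preserving_toLp (Fin 3)
  have h := h3.comp (h2.comp h1)
  refine (congrArg (fun F => MeasurePreserving F _ _) ?_).mp h
  funext p
  ext i
  fin_cases i <;> rfl

/-- The projection of `Ω` to the plane. -/
def planarDomain (Ω : Opens Space) : Set Plane := ⋃ z, (slice Ω z : Set Plane)

theorem isOpen_planarDomain (Ω : Opens Space) : IsOpen (planarDomain Ω) :=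
  isOpen_iUnion fun z => (slice Ω z).isOpen

theorem mem_planarDomain {Ω : Opens Space} {y : Plane} :
    y ∈ planarDomain Ω ↔ ∃ z, lift z y ∈ Ω := by
  simp only [planarDomain, Set.mem_iUnion]
  rfl

theorem slice_subset_planarDomain (Ω : Opens Space) (z : ℝ) :
    (slice Ω z : Set Plane) ⊆ planarDomain Ω :=
  Set.subset_iUnion (fun z => (slice Ω z : Set Plane)) z

theorem lift_mem_offLine {Ω : Opens Space} {z : ℝ} {y : Plane} (h : lift z y ∈ Ω) (hy : y ≠ 0) :
    lift z y ∈ offLine Ω :=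
  ⟨h, by rwa [planar_lift]⟩

theorem planar_mem_planarDomain {Ω : Opens Space} {x : Space} (hx : x ∈ offLine Ω) :
    planar x ∈ planarDomain Ω \ {0} :=
  ⟨mem_planarDomain.2 ⟨x 2, by rw [lift_planar]; exact hx.1⟩, hx.2⟩

open Classical in
/-- The planar field defined by a tensor field that does not depend on the height. -/
noncomputable def planarStrain (Ω : Opens Space) (S : Space → Matrix (Fin 3) (Fin 3) ℝ)
    (y : Plane) : Matrix (Fin 3) (Fin 3) ℝ :=
  -- The default 0 is taken at the origin and outside the projection of `Ω`; the chosen height is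
  -- immaterial when `S` is independent of z.
  if h : ∃ z, lift z y ∈ offLine Ω then S (lift h.choose y) else 0

end Geometry

/-! ### Descent of the strain to the plane -/

namespace StrainDecomp.IsStrain2D

variable {Ω : Opens Space} {S : Space → Matrix (Fin 3) (Fin 3) ℝ}

theorem planarStrain_planar (hS : IsStrain2D Ω S) {x : Space} (hx : x ∈ offLine Ω) :
    planarStrain Ω S (planar x) = S x := by
  have h : ∃ z, lift z (planar x) ∈ offLine Ω := ⟨x 2, by rwa [lift_planar]⟩
  rw [planarStrain, dif_pos h]
  exact hS.indep_z _ h.choose_spec _ hx (planar_lift _ _)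

theorem isSymm_planarStrain (hS : IsStrain2D Ω S) (y : Plane) :
    (planarStrain Ω S y).IsSymm := by
  unfold planarStrain
  split_ifs with h
  · exact hS.symm _ h.choose_spec
  · exact Matrix.transpose_zero

theorem planarStrain_eq (hS : IsStrain2D Ω S) {z : ℝ} {y : Plane} (h : lift z y ∈ Ω)
    (hy : y ≠ 0) : planarStrain Ω S y = S (lift z y) := by
  rw [← hS.planarStrain_planar (lift_mem_offLine h hy), planar_lift]

theorem contDiffOn_planarStrain (hS : IsStrain2D Ω S) (i j : Fin 3) :
    ContDiffOn ℝ ∞ (fun y => planarStrain Ω S y i j) (planarDomain Ω \ {0}) := by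
  intro y hy
  obtain ⟨z, hz⟩ := mem_planarDomain.1 hy.1
  have hx := lift_mem_offLine hz hy.2
  have h1 : ContDiffAt ℝ ∞ (fun y => S (lift z y) i j) y :=
    ((hS.smooth i j).contDiffAt ((isOpen_offLine Ω).mem_nhds hx)).comp y (contDiff_lift z).contDiffAt
  refine (h1.congr_of_eventuallyEq ?_).contDiffWithinAt
  filter_upwards [((isOpen_offLine Ω).preimage (continuous_lift z)).mem_nhds hx] with y' hy'
  rw [hS.planarStrain_eq hy'.1 (by simpa [planar_lift] using hy'.2)]

/-- Around each point `Ω` contains a product of an interval and a disc. There the integrand does not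
depend on the height, and the interval has positive finite length, so integrability on the product
forces integrability on the disc. This includes discs around the origin. -/
theorem locallyIntegrableOn_planarStrain (hS : IsStrain2D Ω S) (i j : Fin 3) :
    LocallyIntegrableOn (fun y => planarStrain Ω S y i j) (planarDomain Ω) := by
  intro y hy
  obtain ⟨z, hz⟩ := mem_planarDomain.1 hy
  have hcont : Continuous fun p : ℝ × Plane => lift p.1 p.2 := by
    unfold lift
    refine (PiLp.continuous_toLp 2 _).comp (continuous_pi fun i => ?_)
    fin_cases i
    · exact (EuclideanSpace.proj (0 : Fin 2) : Plane →L[ℝ] ℝ).continuous.comp continuous_snd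
    · exact (EuclideanSpace.proj (1 : Fin 2) : Plane →L[ℝ] ℝ).continuous.comp continuous_snd
    · exact continuous_fst
  obtain ⟨r, hr, hrΩ⟩ := Metric.mem_nhds_iff.1 ((Ω.isOpen.preimage hcont).mem_nhds
    (show lift (z, y).1 (z, y).2 ∈ (Ω : Set Space) from hz))
  rw [← ball_prod_same] at hrΩ
  have hint : IntegrableOn (fun p : ℝ × Plane => S (lift p.1 p.2) i j)
      (Metric.ball z r ×ˢ Metric.ball y r) (volume.prod volume) := by
    have h1 := measurePreserving_lift.integrable_comp_of_integrable
      ((integrable_indicator_iff Ω.isOpen.measurableSet).2 (hS.integrable i j))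
    refine h1.integrableOn.congr_fun (fun p hp => ?_)
      (measurableSet_ball.prod measurableSet_ball)
    have hpΩ : lift p.1 p.2 ∈ (Ω : Set Space) := hrΩ hp
    exact Set.indicator_of_mem hpΩ _
  rw [IntegrableOn, ← Measure.prod_restrict] at hint
  have hae : (fun p : ℝ × Plane => S (lift p.1 p.2) i j) =ᵐ[(volume.restrict (Metric.ball z r)).prod
      (volume.restrict (Metric.ball y r))] fun p => planarStrain Ω S p.2 i j := by
    have h1 : ∀ᵐ p ∂(volume.restrict (Metric.ball z r)).prod
        (volume.restrict (Metric.ball y r)), p ∈ Metric.ball z r ×ˢ Metric.ball y r := by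
      rw [Measure.prod_restrict]
      exact ae_restrict_mem (measurableSet_ball.prod measurableSet_ball)
    -- The defect line is null, so the default value at the origin does not matter.
    have h2 : ∀ᵐ p ∂(volume.restrict (Metric.ball z r)).prod
        (volume.restrict (Metric.ball y r)), p.2 ≠ 0 :=
      Measure.quasiMeasurePreserving_snd.ae (Measure.ae_ne _ 0)
    filter_upwards [h1, h2] with p hp hp0
    rw [hS.planarStrain_eq (hrΩ hp) hp0]
  have : IsFiniteMeasure ((volume : Measure ℝ).restrict (Metric.ball z r)) :=
    ⟨by rw [Measure.restrict_apply_univ]; exact measure_ball_lt_top⟩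
  have hball := (integrable_congr hae).1 hint
  rw [Integrable.comp_snd_iff (f := fun y => planarStrain Ω S y i j)] at hball
  · exact ⟨Metric.ball y r, nhdsWithin_le_nhds (Metric.ball_mem_nhds y hr), hball⟩
  · rw [Ne, Measure.restrict_eq_zero]
    exact (Metric.measure_ball_pos volume z hr).ne'

theorem pd_eq (hS : IsStrain2D Ω S) (γ : Fin 2) (i j : Fin 3) {x : Space}
    (hx : x ∈ offLine Ω) : pd (sp γ) (fun y => S y i j) x =
      pd γ (fun y => planarStrain Ω S y i j) (planar x) := by
  have hev : (fun y => S y i j) =ᶠ[𝓝 x] fun y => planarStrain Ω S (planar y) i j := by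
    filter_upwards [(isOpen_offLine Ω).mem_nhds hx] with y hy
    rw [hS.planarStrain_planar hy]
  rw [(pd_congr hev (sp γ)).eq_of_nhds]
  exact pd_comp_planar (f := fun y => planarStrain Ω S y i j)
    ((hS.contDiffOn_planarStrain i j).differentiableAt_of_isOpen
      ((isOpen_planarDomain Ω).sdiff isClosed_singleton) (planar_mem_planarDomain hx)) γ

theorem pd_pd_eq (hS : IsStrain2D Ω S) (γ δ : Fin 2) (i j : Fin 3) {x : Space}
    (hx : x ∈ offLine Ω) : pd (sp γ) (pd (sp δ) fun y => S y i j) x =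
      pd γ (pd δ fun y => planarStrain Ω S y i j) (planar x) := by
  have hopen := (isOpen_planarDomain Ω).sdiff (isClosed_singleton (x := (0 : Plane)))
  have hev : pd (sp δ) (fun y => S y i j) =ᶠ[𝓝 x]
      fun y => pd δ (fun y => planarStrain Ω S y i j) (planar y) := by
    filter_upwards [(isOpen_offLine Ω).mem_nhds hx] with y hy
    exact hS.pd_eq δ i j hy
  rw [(pd_congr hev (sp γ)).eq_of_nhds]
  exact pd_comp_planar (((hS.contDiffOn_planarStrain i j).pd hopen δ).differentiableAt_of_isOpen
    hopen (planar_mem_planarDomain hx)) γ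

end StrainDecomp.IsStrain2D

/-! ### Assembly of the two decompositions -/

theorem mainTheorem5 (Ω : Opens Space) (S : Space → Matrix (Fin 3) (Fin 3) ℝ)
    (hS : IsStrain2D Ω S) (hR : HasRadonDivTrace Ω S) :
    (∃ E e : Fin 2 → Plane → ℝ,
      (∀ x ∈ offLine Ω, ∀ κ, S x (sp κ) zi = E κ (planar x) + e κ (planar x)) ∧
      (∀ z κ, LocallyIntegrableOn (E κ) (slice Ω z) ∧ LocallyIntegrableOn (e κ) (slice Ω z)) ∧
      (∀ z, curl (slice Ω z) E = 0) ∧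
      (∀ κ, e κ =o[𝓝[≠] 0] fun y => (‖y‖ ^ 2)⁻¹)) ∧
    (∃ E e : Fin 2 → Fin 2 → Plane → ℝ,
      (∀ α β, E α β = E β α ∧ e α β = e β α) ∧
      (∀ x ∈ offLine Ω, ∀ α β,
        S x (sp α) (sp β) = E α β (planar x) + e α β (planar x)) ∧
      (∀ z α β, LocallyIntegrableOn (E α β) (slice Ω z) ∧
        LocallyIntegrableOn (e α β) (slice Ω z)) ∧
      (∀ z, incompat (slice Ω z) E = 0) ∧
      (∀ α β, e α β =o[𝓝[≠] 0] fun y => (‖y‖ ^ 2)⁻¹)) := by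
  have hlift : ∀ y ∈ planarDomain Ω \ {0}, ∃ x ∈ offLine Ω, planar x = y := fun y hy => by
    obtain ⟨z, hz⟩ := mem_planarDomain.1 hy.1
    exact ⟨lift z y, lift_mem_offLine hz hy.2, planar_lift z y⟩
  have hopen := isOpen_planarDomain Ω
  constructor
  · obtain ⟨K, hK⟩ := hS.compat_shear
    -- The correction is made once on the union of all slices, so one pair of fields serves every
    -- height; a test function on a slice is also one on the union.
    obtain ⟨e, he, heo, hflux⟩ := exists_curl_correction hopen
      (w := fun κ y => planarStrain Ω S y (sp κ) zi)
      (fun κ => hS.contDiffOn_planarStrain _ _)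
      (fun κ => hS.locallyIntegrableOn_planarStrain _ _) (K := K) (fun y hy => by
        obtain ⟨x, hx, rfl⟩ := hlift y hy
        rw [← hK x hx]
        simp only [hS.pd_eq _ _ _ hx])
    have hE : ∀ z κ, LocallyIntegrableOn
        (fun y => planarStrain Ω S y (sp κ) zi - e κ y) (slice Ω z) := fun z κ =>
      ((hS.locallyIntegrableOn_planarStrain _ _).mono_set (slice_subset_planarDomain Ω z)).sub
        ((he κ).locallyIntegrableOn _)
    refine ⟨fun κ y => planarStrain Ω S y (sp κ) zi - e κ y, e, fun x hx κ => ?_,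
      fun z κ => ⟨hE z κ, (he κ).locallyIntegrableOn _⟩, fun z => curl_eq_zero (hE z) fun φ hφ =>
        hflux φ (hφ.mono (slice_subset_planarDomain Ω z)), heo⟩
    simp only [hS.planarStrain_planar hx, sub_add_cancel]
  · obtain ⟨e, hsymm, he, heo, hflux⟩ := exists_incompat_correction hopen
      (s := fun α β y => planarStrain Ω S y (sp α) (sp β))
      (fun α β => hS.contDiffOn_planarStrain _ _)
      (fun α β => hS.locallyIntegrableOn_planarStrain _ _) (fun y hy => by
        obtain ⟨x, hx, rfl⟩ := hlift y hy
        rw [← hS.compat_planar x hx]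
        simp only [hS.pd_pd_eq _ _ _ _ hx])
    have hE : ∀ z α β, LocallyIntegrableOn
        (fun y => planarStrain Ω S y (sp α) (sp β) - e α β y) (slice Ω z) := fun z α β =>
      ((hS.locallyIntegrableOn_planarStrain _ _).mono_set (slice_subset_planarDomain Ω z)).sub
        ((he α β).locallyIntegrableOn _)
    refine ⟨fun α β y => planarStrain Ω S y (sp α) (sp β) - e α β y, e, fun α β => ⟨?_, hsymm α β⟩,
      fun x hx α β => ?_, fun z α β => ⟨hE z α β, (he α β).locallyIntegrableOn _⟩,
      fun z => incompat_eq_zero (hE z) fun φ hφ =>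
        hflux φ (hφ.mono (slice_subset_planarDomain Ω z)), heo⟩
    · funext y
      simp only [hsymm α β, (hS.isSymm_planarStrain y).apply]
    · simp only [hS.planarStrain_planar hx, sub_add_cancel]
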